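/- Let a closed curve be a smooth immersion $S^1\to\mathbb R^2$ (with orientation) whose only singular points are finitely many transversal double points; its index $i$ is its rotation number (counterclockwise positive). For a base point which is not a double point, let $w_\Gamma$ be the word of double points in the order of passage; a double point has sign $+1$ if (velocity of the second passage, velocity of the first passage) is a positive frame, and $-1$ otherwise. For a Gauss word $v$ let $\langle v,w_\Gamma\rangle$ be the sum, over all Gauss sub-words $v'$ of $w_\Gamma$ isomorphic to $v$, of the product of the signs of the letters of $v'$. Put $$CI_3(\Gamma;s,t)=\langle s\,[XYXYZZ]+t\,[XXYYZZ],\,w_\Gamma\rangle+i,$$ where $[XYXYZZ]=XYXYZZ-YXYZZX+XYZZXY-YZZXYX+ZZXYXY-ZXYXYZ$ and $[XXYYZZ]=XXYYZZ-XYYZZX$. Let $J^+,J^-,St$ be Arnold's basic invariants, determined by: $J^+$ increases by $2$ under a positive move $I\!I^+$ ($xyz\to xAByABz$, $\mathrm{sign}A=-\mathrm{sign}B$), $J^-$ decreases by $2$ under a positive move $I\!I^-$ ($xyz\to xAByBAz$, $\mathrm{sign}A=-\mathrm{sign}B$), $St$ increases by $1$ under a positive move $I\!I\!I$ ($xAByACzBCt\to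 xBAyCAzCBt$, equal signs of $A,B,C$), each is unchanged under the other moves, and $(J^+,J^-,St)$ is $(0,-1,0)$ on the figure eight $K_0$ and $(-2j,-3j,j)$ on the circle $K_{j+1}$ with $j$ small inner loops of the same rotation direction. Let $P(\Gamma)\in\mathbb Z[x,y^{\pm1},z_{\pm1},z_{\pm2},\dots]$ be the HOMFLY polynomial of immersed plane curves (the framed HOMFLY polynomial of the Legendrian lift to $ST^*\mathbb R^2$), defined on generic collections of closed plane curves by: invariance under regular homotopies without direct self-tangencies; $P(\Gamma_2)-P(\Gamma_0)=y\,P(\Gamma_1)$ for collections that coincide outside a disc and inside it consist of two codirected strands with $2$, $0$, $1$ crossings, respectively; multiplication by $x^2$ when a pair of opposite kinks is inserted; multiplication by $z_k$ ($k\neq0$), respectively $(1-x^2)/y$ ($k=0$), when the standard curve $K_k$ of index $k$ (for $k<0$, $K_{|k|}$ with the clockwise orientation) is added in a half-plane disjoint from the other curves; $P(\emptyset)=1$. **Corollary.** There are two closed plane curves $\Gamma_1,\Gamma_2$ such that for both of them $$i=2,\qquad (J^+,J^-,St)=(-4,-7,2),\qquad P=x^2z_2,$$ whereas, for every choice of base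 points, $$CI_3(\Gamma_1;s,t)=t+2,\qquad CI_3(\Gamma_2;s,t)=-t+2 ;$$ in particular $CI_3(\Gamma_1;s,t)\ne CI_3(\Gamma_2;s,t)$ whenever $t\neq0$. Hence $CI_3$ is independent of the index, Arnold's basic invariants and the HOMFLY polynomial of immersed plane curves. -/

import Mathlib

open scoped ContDiff

namespace CurveWords

/-! ### Generic immersed curves in the oriented plane `ℂ` -/

/-- `cross u v = u.re * v.im - u.im * v.re`: positive iff `(u, v)` is a positive frame. -/
def cross (u v : ℂ) : ℝ := u.re * v.im - u.im * v.re

/-- Two parameters `(i, s)`, `(j, t)` give different points of `n` copies of the circle `ℝ/ℤ`. -/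
def Apart {n : ℕ} (p q : Fin n × ℝ) : Prop :=
  p.1 ≠ q.1 ∨ ∀ k : ℤ, q.2 ≠ p.2 + k

/-- A generic collection of `n` oriented closed plane curves: smooth immersions of circles `ℝ/ℤ`
(given as `1`-periodic maps on `ℝ`), whose only singular points are finitely many transversal
double points. -/
structure PlaneCurves (n : ℕ) where
  γ : Fin n → ℝ → ℂ
  smooth : ∀ i, ContDiff ℝ ∞ (γ i)
  periodic : ∀ i, Function.Periodic (γ i) 1
  immersed : ∀ i t, deriv (γ i) t ≠ 0
  transversal : ∀ p q : Fin n × ℝ, Apart p q → γ p.1 p.2 = γ q.1 q.2 →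
    cross (deriv (γ p.1) p.2) (deriv (γ q.1) q.2) ≠ 0
  no_triple : ∀ p q r : Fin n × ℝ, Apart p q → Apart q r → Apart p r →
    ¬ (γ p.1 p.2 = γ q.1 q.2 ∧ γ q.1 q.2 = γ r.1 r.2)
  finite_double : {z : ℂ | ∃ p q : Fin n × ℝ, Apart p q ∧ γ p.1 p.2 = z ∧ γ q.1 q.2 = z}.Finite

/-- The empty collection of curves. -/
def emptyCurves : PlaneCurves 0 where
  γ := fun i => i.elim0
  smooth := fun i => i.elim0
  periodic := fun i => i.elim0
  immersed := fun i => i.elim0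
  transversal := fun p => p.1.elim0
  no_triple := fun p => p.1.elim0
  finite_double := by
    refine Set.Finite.subset Set.finite_empty ?_
    rintro z ⟨p, -⟩
    exact p.1.elim0

/-- A closed plane curve: an immersed circle whose singular points are transversal double points. -/
abbrev ClosedCurve : Type := PlaneCurves 1

namespace ClosedCurve

/-- The parametrization of a closed curve. -/
def param (Γ : ClosedCurve) : ℝ → ℂ := Γ.γ 0

/-- The index (rotation number, counterclockwise positive): the total variation
of the angle of the velocity, divided by `2π`. It is an integer, kept here as a real number. -/
noncomputable def index (Γ : ClosedCurve) : ℝ :=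
  (2 * Real.pi)⁻¹ * ∫ t in (0 : ℝ)..1, (deriv (deriv Γ.param) t / deriv Γ.param t).im

/-- `b` is (the parameter of) a base point: not a double point of the curve. -/
def IsBasePoint (Γ : ClosedCurve) (b : ℝ) : Prop :=
  ∀ t, Γ.param t = Γ.param b → ∃ k : ℤ, t = b + k

/-- The parameters in `(b, b + 1)` at which the curve passes through a double point. -/
def doubleParams (Γ : ClosedCurve) (b : ℝ) : Set ℝ :=
  {s | s ∈ Set.Ioo b (b + 1) ∧ ∃ t ∈ Set.Ioo b (b + 1), t ≠ s ∧ Γ.param t = Γ.param s}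

lemma doubleParams_finite (Γ : ClosedCurve) (b : ℝ) : (Γ.doubleParams b).Finite := by
  have hap : ∀ s t : ℝ, s ∈ Set.Ioo b (b + 1) → t ∈ Set.Ioo b (b + 1) → t ≠ s →
      Apart ((0 : Fin 1), s) ((0 : Fin 1), t) := by
    intro s t hs ht hne
    right
    intro k hk
    simp only [Set.mem_Ioo] at hs ht
    simp only at hk
    have h1 : (k : ℝ) < 1 := by linarith
    have h2 : (-1 : ℝ) < k := by linarith
    have h3 : k < 1 := by exact_mod_cast h1
    have h4 : -1 < k := by exact_mod_cast h2
    have h5 : k = 0 := by omega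
    subst h5
    simp at hk
    exact hne hk
  refine Set.Finite.of_finite_fibers (f := Γ.param) (Γ.finite_double.subset ?_) ?_
  · rintro z ⟨s, ⟨hs, t, ht, hne, he⟩, rfl⟩
    exact ⟨(0, s), (0, t), hap s t hs ht hne, rfl, he⟩
  · rintro z -
    by_contra hinf
    obtain ⟨u, hu, hc⟩ := (Set.not_finite.mp hinf).exists_subset_card_eq 3
    obtain ⟨a, c, d, hac, had, hcd, rfl⟩ := Finset.card_eq_three.mp hc
    have ha := hu (show a ∈ (↑({a, c, d} : Finset ℝ) : Set ℝ) by simp)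
    have hc' := hu (show c ∈ (↑({a, c, d} : Finset ℝ) : Set ℝ) by simp)
    have hd := hu (show d ∈ (↑({a, c, d} : Finset ℝ) : Set ℝ) by simp)
    have ea : Γ.param a = z := ha.2
    have ec : Γ.param c = z := hc'.2
    have ed : Γ.param d = z := hd.2
    exact Γ.no_triple (0, a) (0, c) (0, d) (hap _ _ ha.1.1 hc'.1.1 hac.symm)
      (hap _ _ hc'.1.1 hd.1.1 hcd.symm) (hap _ _ ha.1.1 hd.1.1 had.symm)
      ⟨ea.trans ec.symm, ec.trans ed.symm⟩

end ClosedCurve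

/-! ### Words -/

/-- A word together with a sign for each letter. It is a nanoword over `{-1, 1}` when every letter
of the word occurs exactly twice and has sign `±1`, as is the case for the words of curves. -/
structure Nanoword (α : Type) where
  word : List α
  sign : α → ℤ

/-- Isomorphism of nanowords: a sign preserving bijective renaming of the letters. -/
def Nanoword.Iso {α β : Type} (w : Nanoword α) (w' : Nanoword β) : Prop :=
  ∃ f : α → β, Set.InjOn f {a | a ∈ w.word} ∧ w'.word = w.word.map f ∧
    ∀ a ∈ w.word, w'.sign (f a) = w.sign a

/-- Isomorphism of plain words. -/
def WordIso {α β : Type} (v : List α) (v' : List β) : Prop :=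
  ∃ f : α → β, Set.InjOn f {a | a ∈ v} ∧ v' = v.map f

open Classical in
/-- The pairing `⟨v, w⟩` of a Gauss word and a nanoword: the sum, over the Gauss sub-words `v'` of
`w` isomorphic to `v`, of the product of the signs of the letters of `v'`. (A Gauss sub-word of a
nanoword consists of both occurrences of each letter of some set `S` of letters.) -/
noncomputable def pairing {α β : Type} (v : List α) (w : Nanoword β) : ℤ :=
  ∑ S ∈ w.word.toFinset.powerset,
    if WordIso v (w.word.filter (fun a => decide (a ∈ S))) then ∏ a ∈ S, w.sign a else 0

open Classical in
/-- The nanoword of a closed curve pointed at `b`. The letters are the double points, in the order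
in which the curve passes through them from the base point. A double point has sign `1` if the
velocity of the second passage followed by that of the first one is a positive frame, and `-1`
otherwise; so a small counterclockwise loop not containing the base point has sign `1`. -/
noncomputable def ClosedCurve.nanoword (Γ : ClosedCurve) (b : ℝ) : Nanoword ℂ where
  word := ((Γ.doubleParams_finite b).toFinset.sort).map Γ.param
  sign := fun z =>
    match ((Γ.doubleParams_finite b).toFinset.sort).filter
        (fun t => decide (Γ.param t = z)) with
    | [p, q] => if 0 < cross (deriv Γ.param q) (deriv Γ.param p) then 1 else -1
    | _ => 0

/-! ### The invariant `CI₃` -/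

/-- The class `[XYXYZZ]`, paired with a nanoword. -/
noncomputable def pairXYXYZZ {α : Type} (w : Nanoword α) : ℤ :=
  let X := 0; let Y := 1; let Z := 2
  pairing [X, Y, X, Y, Z, Z] w - pairing [Y, X, Y, Z, Z, X] w + pairing [X, Y, Z, Z, X, Y] w
    - pairing [Y, Z, Z, X, Y, X] w + pairing [Z, Z, X, Y, X, Y] w - pairing [Z, X, Y, X, Y, Z] w

/-- The class `[XXYYZZ]`, paired with a nanoword. -/
noncomputable def pairXXYYZZ {α : Type} (w : Nanoword α) : ℤ :=
  let X := 0; let Y := 1; let Z := 2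
  pairing [X, X, Y, Y, Z, Z] w - pairing [X, Y, Y, Z, Z, X] w

/-- `CI₃(Γ; s, t)`, computed with the base point `b`. -/
noncomputable def CI3 (Γ : ClosedCurve) (b s t : ℝ) : ℝ :=
  s * pairXYXYZZ (Γ.nanoword b) + t * pairXXYYZZ (Γ.nanoword b) + Γ.index

/-! ### Standard curves, elementary moves, and Arnold's basic invariants -/

/-- `Γ` is the standard curve `K_k` of index `k`: for `k > 0` a counterclockwise circle with `k - 1`
small counterclockwise inner loops, for `k < 0` a clockwise circle with `|k| - 1` small clockwise
inner loops, for `k = 0` the figure eight. (Up to plane isotopy these curves are determined by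
their word and index.) -/
def IsStandard (k : ℤ) (Γ : ClosedCurve) : Prop :=
  Γ.index = k ∧ ∃ b, Γ.IsBasePoint b ∧
    (Nanoword.mk ((List.range (if k = 0 then 1 else k.natAbs - 1)).flatMap (fun a => [a, a]))
      (fun _ => if k < 0 then -1 else 1)).Iso (Γ.nanoword b)

/-- Positive elementary move `II⁺` on nanowords: `xyz → xAByABz` with `τ(sign A) = sign B`. -/
def WordMoveIIPlus {α β : Type} (w : Nanoword α) (w' : Nanoword β) : Prop :=
  ∃ (x y z : List ℕ) (A B : ℕ) (σ : ℕ → ℤ), A ≠ B ∧ A ∉ x ++ y ++ z ∧ B ∉ x ++ y ++ z ∧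
    σ B = - σ A ∧ (Nanoword.mk (x ++ y ++ z) σ).Iso w ∧
    (Nanoword.mk (x ++ [A, B] ++ y ++ [A, B] ++ z) σ).Iso w'

/-- Positive elementary move `II⁻` on nanowords: `xyz → xAByBAz` with `τ(sign A) = sign B`. -/
def WordMoveIIMinus {α β : Type} (w : Nanoword α) (w' : Nanoword β) : Prop :=
  ∃ (x y z : List ℕ) (A B : ℕ) (σ : ℕ → ℤ), A ≠ B ∧ A ∉ x ++ y ++ z ∧ B ∉ x ++ y ++ z ∧
    σ B = - σ A ∧ (Nanoword.mk (x ++ y ++ z) σ).Iso w ∧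
    (Nanoword.mk (x ++ [A, B] ++ y ++ [B, A] ++ z) σ).Iso w'

/-- Positive elementary move `III` on nanowords: `xAByACzBCt → xBAyCAzCBt` with
`(sign A, sign B, sign C)` equal to `(-1, -1, -1)` or `(1, 1, 1)`. -/
def WordMoveIII {α β : Type} (w : Nanoword α) (w' : Nanoword β) : Prop :=
  ∃ (x y z t : List ℕ) (A B C : ℕ) (σ : ℕ → ℤ), A ≠ B ∧ A ≠ C ∧ B ≠ C ∧
    A ∉ x ++ y ++ z ++ t ∧ B ∉ x ++ y ++ z ++ t ∧ C ∉ x ++ y ++ z ++ t ∧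
    σ A = σ B ∧ σ B = σ C ∧
    (Nanoword.mk (x ++ [A, B] ++ y ++ [A, C] ++ z ++ [B, C] ++ t) σ).Iso w ∧
    (Nanoword.mk (x ++ [B, A] ++ y ++ [C, A] ++ z ++ [C, B] ++ t) σ).Iso w'

/-- An elementary move between plane curves: the index is unchanged (as under every regular
homotopy) and, for suitable base points, the nanowords are related by the given word move. -/
def CurveMove (R : Nanoword ℂ → Nanoword ℂ → Prop) (Γ Γ' : ClosedCurve) : Prop :=
  Γ.index = Γ'.index ∧ ∃ b b', Γ.IsBasePoint b ∧ Γ'.IsBasePoint b' ∧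
    R (Γ.nanoword b) (Γ'.nanoword b')

/-- `ArnoldValue Γ p m s`: the values `(J⁺(Γ), J⁻(Γ), St(Γ)) = (p, m, s)` result from the defining
properties of Arnold's basic invariants, namely their values on the standard curves and their jumps
under the elementary moves and the inverses of these. -/
inductive ArnoldValue : ClosedCurve → ℤ → ℤ → ℤ → Prop
  | figureEight (Γ : ClosedCurve) : IsStandard 0 Γ → ArnoldValue Γ 0 (-1) 0
  | standard (k : ℤ) (i : ℕ) (Γ : ClosedCurve) : k.natAbs = i + 1 → IsStandard k Γ →
      ArnoldValue Γ (-2 * i) (-3 * i) i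
  | moveIIPlus (Γ Γ' : ClosedCurve) (p m s : ℤ) : CurveMove WordMoveIIPlus Γ Γ' →
      ArnoldValue Γ p m s → ArnoldValue Γ' (p + 2) m s
  | moveIIPlus_inv (Γ Γ' : ClosedCurve) (p m s : ℤ) : CurveMove WordMoveIIPlus Γ' Γ →
      ArnoldValue Γ p m s → ArnoldValue Γ' (p - 2) m s
  | moveIIMinus (Γ Γ' : ClosedCurve) (p m s : ℤ) : CurveMove WordMoveIIMinus Γ Γ' →
      ArnoldValue Γ p m s → ArnoldValue Γ' p (m - 2) s
  | moveIIMinus_inv (Γ Γ' : ClosedCurve) (p m s : ℤ) : CurveMove WordMoveIIMinus Γ' Γ →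
      ArnoldValue Γ p m s → ArnoldValue Γ' p (m + 2) s
  | moveIII (Γ Γ' : ClosedCurve) (p m s : ℤ) : CurveMove WordMoveIII Γ Γ' →
      ArnoldValue Γ p m s → ArnoldValue Γ' p m (s + 1)
  | moveIII_inv (Γ Γ' : ClosedCurve) (p m s : ℤ) : CurveMove WordMoveIII Γ' Γ →
      ArnoldValue Γ p m s → ArnoldValue Γ' p m (s - 1)

/-! ### The HOMFLY polynomial of immersed plane curves

This is the framed HOMFLY polynomial of the Legendrian lift of the curves to the manifold
`ST*ℝ²` of cooriented contact elements, expressed through the curves alone. -/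

/-- The set of pairs (point, unit tangent vector) of a collection of curves. For a generic
collection it determines the oriented curves up to reparametrization and renumbering. -/
def tangentLift {n : ℕ} (Γ : PlaneCurves n) : Set (ℂ × ℂ) :=
  {p | ∃ i t, p = (Γ.γ i t, deriv (Γ.γ i) t / ‖deriv (Γ.γ i) t‖)}

/-- `Γ` and `Γ'` are joined by a smooth regular homotopy in which two branches never pass through
the same point in the same direction, i.e. without direct self-tangencies (equivalently, the
Legendrian lift undergoes an isotopy). -/
def LegendrianIsotopic {n : ℕ} (Γ Γ' : PlaneCurves n) : Prop :=
  ∃ F : Fin n → ℝ → ℝ → ℂ,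
    (∀ i, ContDiff ℝ ∞ (fun p : ℝ × ℝ => F i p.1 p.2)) ∧
    (∀ i, F i 0 = Γ.γ i) ∧ (∀ i, F i 1 = Γ'.γ i) ∧
    ∀ τ ∈ Set.Icc (0 : ℝ) 1,
      (∀ i, Function.Periodic (F i τ) 1) ∧ (∀ i t, deriv (F i τ) t ≠ 0) ∧
      ∀ p q : Fin n × ℝ, Apart p q → F p.1 τ p.2 = F q.1 τ q.2 →
        ¬ SameRay ℝ (deriv (F p.1 τ) p.2) (deriv (F q.1 τ) q.2)

/-- The open square in which the local relations take place. -/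
def box : Set ℂ := {z | |z.re| < 1 ∧ |z.im| < 1}

/-- The part inside `box` of the tangent lift. -/
def liftInBox {n : ℕ} (Γ : PlaneCurves n) : Set (ℂ × ℂ) := {p ∈ tangentLift Γ | p.1 ∈ box}

/-- The part outside `box` of the tangent lift. -/
def liftOutsideBox {n : ℕ} (Γ : PlaneCurves n) : Set (ℂ × ℂ) := {p ∈ tangentLift Γ | p.1 ∉ box}

/-- The tangent lift of an arc `κ : (a, b) → ℂ`. -/
def arcLift (κ : ℝ → ℂ) (a b : ℝ) : Set (ℂ × ℂ) :=
  {p | ∃ t ∈ Set.Ioo a b, p = (κ t, deriv κ t / ‖deriv κ t‖)}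

/-- The graph of `f`, directed to the right. -/
noncomputable def graphArc (f : ℝ → ℝ) : ℝ → ℂ := fun x => ⟨x, f x⟩

/-- `f` is smooth and its graph over `[-1, 1]` avoids the top and the bottom of the box. -/
def IsStrand (f : ℝ → ℝ) : Prop := ContDiff ℝ ∞ f ∧ ∀ x ∈ Set.Icc (-1 : ℝ) 1, |f x| < 1

/-- Inside the box, `Γ` consists of the two strands `f` and `g`, both directed to the right, and
`f` starts above `g`. -/
def TwoStrands {n : ℕ} (Γ : PlaneCurves n) (f g : ℝ → ℝ) : Prop :=
  IsStrand f ∧ IsStrand g ∧ g (-1) < f (-1) ∧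
    liftInBox Γ = arcLift (graphArc f) (-1) 1 ∪ arcLift (graphArc g) (-1) 1

/-- The three collections coincide outside the box; inside it each consists of two strands directed
to the right, which cross exactly twice for `Γ₂`, exactly once for `Γ₁`, and never for `Γ₀`. Thus
`Γ₂` and `Γ₀` differ by a passage through a direct self-tangency, and the Legendrian lift of `Γ₁`
is the smoothing of the double point of the lift at the moment of tangency. -/
def TangencyTriple {l m n : ℕ} (Γ₂ : PlaneCurves l) (Γ₀ : PlaneCurves m) (Γ₁ : PlaneCurves n) :
    Prop :=
  liftOutsideBox Γ₂ = liftOutsideBox Γ₀ ∧ liftOutsideBox Γ₁ = liftOutsideBox Γ₀ ∧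
  (∃ f g, TwoStrands Γ₂ f g ∧ g 1 < f 1 ∧ {x ∈ Set.Icc (-1 : ℝ) 1 | f x = g x}.ncard = 2) ∧
  (∃ f g, TwoStrands Γ₀ f g ∧ ∀ x ∈ Set.Icc (-1 : ℝ) 1, g x < f x) ∧
  (∃ f g, TwoStrands Γ₁ f g ∧ f 1 < g 1 ∧ {x ∈ Set.Icc (-1 : ℝ) 1 | f x = g x}.ncard = 1)

/-- `Γ'` arises from `Γ` by inserting a pair of opposite kinks: the collections coincide outside the
box; inside it `Γ` is a single strand `f`, and `Γ'` is a single immersed arc with the same ends that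
first makes one simple loop and then another one, with opposite signs (word `AABB`,
`sign B = -sign A`), and has no further double points. -/
def KinkPair {m n : ℕ} (Γ : PlaneCurves m) (Γ' : PlaneCurves n) : Prop :=
  liftOutsideBox Γ' = liftOutsideBox Γ ∧
  ∃ (f : ℝ → ℝ) (κ : ℝ → ℂ) (a₁ a₂ b₁ b₂ : ℝ),
    IsStrand f ∧ liftInBox Γ = arcLift (graphArc f) (-1) 1 ∧
    ContDiff ℝ ∞ κ ∧ (∀ t ∈ Set.Icc (0 : ℝ) 1, deriv κ t ≠ 0) ∧
    κ 0 = graphArc f (-1) ∧ κ 1 = graphArc f 1 ∧ (∀ t ∈ Set.Ioo (0 : ℝ) 1, κ t ∈ box) ∧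
    liftInBox Γ' = arcLift κ 0 1 ∧
    0 < a₁ ∧ a₁ < a₂ ∧ a₂ < b₁ ∧ b₁ < b₂ ∧ b₂ < 1 ∧
    (∀ s t, 0 < s → s < t → t < 1 →
      (κ s = κ t ↔ (s = a₁ ∧ t = a₂) ∨ (s = b₁ ∧ t = b₂))) ∧
    cross (deriv κ a₂) (deriv κ a₁) * cross (deriv κ b₂) (deriv κ b₁) < 0

/-- `Γ'` is the disjoint union of `Γ` and the closed curve `K`, with `K` and `Γ` on different sides
of a vertical line. -/
def IsSplitUnion {m n : ℕ} (K : ClosedCurve) (Γ : PlaneCurves m) (Γ' : PlaneCurves n) : Prop :=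
  tangentLift Γ' = tangentLift K ∪ tangentLift Γ ∧
  ∃ c : ℝ, (∀ p ∈ tangentLift K, p.1.re < c) ∧ ∀ p ∈ tangentLift Γ, c < p.1.re

/-- The ring `ℤ[x, y, y⁻¹, z₁, z₋₁, z₂, z₋₂, …]` in which the polynomial takes its values. -/
def HomflyRing : Type :=
  MvPolynomial {k : ℤ // k ≠ 0} (LaurentPolynomial (Polynomial ℤ))

noncomputable instance : CommRing HomflyRing :=
  inferInstanceAs (CommRing (MvPolynomial {k : ℤ // k ≠ 0} (LaurentPolynomial (Polynomial ℤ))))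

/-- The framing variable `x`. -/
noncomputable def homflyX : HomflyRing :=
  (MvPolynomial.C (LaurentPolynomial.C Polynomial.X) :
    MvPolynomial {k : ℤ // k ≠ 0} (LaurentPolynomial (Polynomial ℤ)))

/-- The variable `y`. -/
noncomputable def homflyY : HomflyRing :=
  (MvPolynomial.C (LaurentPolynomial.T 1) :
    MvPolynomial {k : ℤ // k ≠ 0} (LaurentPolynomial (Polynomial ℤ)))

/-- The inverse of `y`. -/
noncomputable def homflyYInv : HomflyRing :=
  (MvPolynomial.C (LaurentPolynomial.T (-1)) :
    MvPolynomial {k : ℤ // k ≠ 0} (LaurentPolynomial (Polynomial ℤ)))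

/-- The variables `z_k`, `k ≠ 0`. -/
noncomputable def homflyZ (k : ℤ) (hk : k ≠ 0) : HomflyRing :=
  (MvPolynomial.X ⟨k, hk⟩ : MvPolynomial {k : ℤ // k ≠ 0} (LaurentPolynomial (Polynomial ℤ)))

/-- The value on the standard curve of index `k`: `z_k` if `k ≠ 0` and `(1 - x²)/y` if `k = 0`. -/
noncomputable def standardValue (k : ℤ) : HomflyRing :=
  if hk : k = 0 then (1 - homflyX ^ 2) * homflyYInv else homflyZ k hk

/-- The free module on all generic collections of closed plane curves. -/
abbrev CurveModule : Type := ((n : ℕ) × PlaneCurves n) →₀ HomflyRing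

/-- The generator of `CurveModule` given by a collection of curves. -/
noncomputable def cls {n : ℕ} (Γ : PlaneCurves n) : CurveModule := Finsupp.single ⟨n, Γ⟩ 1

/-- The defining relations of the HOMFLY polynomial of immersed plane curves. -/
inductive SkeinRelation : CurveModule → Prop
  | reparametrization {m n : ℕ} (Γ : PlaneCurves m) (Γ' : PlaneCurves n) :
      tangentLift Γ = tangentLift Γ' → SkeinRelation (cls Γ - cls Γ')
  | isotopy {n : ℕ} (Γ Γ' : PlaneCurves n) :
      LegendrianIsotopic Γ Γ' → SkeinRelation (cls Γ - cls Γ')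
  | tangency {l m n : ℕ} (Γ₂ : PlaneCurves l) (Γ₀ : PlaneCurves m) (Γ₁ : PlaneCurves n) :
      TangencyTriple Γ₂ Γ₀ Γ₁ → SkeinRelation (cls Γ₂ - cls Γ₀ - homflyY • cls Γ₁)
  | kinks {m n : ℕ} (Γ : PlaneCurves m) (Γ' : PlaneCurves n) :
      KinkPair Γ Γ' → SkeinRelation (cls Γ' - homflyX ^ 2 • cls Γ)
  | splitUnion {m n : ℕ} (k : ℤ) (K : ClosedCurve) (Γ : PlaneCurves m) (Γ' : PlaneCurves n) :
      IsStandard k K → IsSplitUnion K Γ Γ' → SkeinRelation (cls Γ' - standardValue k • cls Γ)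

/-- `HasHomfly Γ P`: the HOMFLY polynomial of `Γ` is `P`, i.e. `Γ` equals `P` times the empty
collection (whose polynomial is `1`) in the quotient of `CurveModule` by the relations. -/
def HasHomfly {n : ℕ} (Γ : PlaneCurves n) (P : HomflyRing) : Prop :=
  cls Γ - P • cls emptyCurves ∈ Submodule.span HomflyRing {r | SkeinRelation r}

end CurveWords

/-! Both curves come from the standard curve `K_2` by inserting the same pair of opposite kinks into
a short strand: for `Γ₁` the strand lies on the inner loop, for `Γ₂` on the outer part. The index is
unaffected. The kink relation gives `P = x² z₂` in both cases, the polynomial of `K_2` being `z₂` by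
the split union with the empty collection (`hasHomfly_standard`, `hasHomfly_kinkPair`).

The insertion can also be performed by moves inside the strand: two moves `II⁻`, one move `III`, and
one inverse move `II⁺`. Their jumps take `(-2, -3, 1)` to `(-4, -7, 2)` wherever the strand lies
(`innerKink_arnoldValue`, `outerKink_arnoldValue`).

The class `[XXYYZZ]` does see the position. No two of the three double points interlace, so
`[XYXYZZ]` pairs to `0`. Seen from a base point on the outer part beside the strand, the letter of
`K_2` encloses the two kinks for `Γ₁`, which matches `XYYZZX` (coefficient `-1`), but not for `Γ₂`,
which matches `XXYYZZ`. The signs multiply to `-1`, so the pairings are `1` and `-1`.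

The curves are realized as closed walks on the square lattice with rounded corners. `path_eq` shows
that rounding creates no new double points, `index_curve` counts the turns, `iso_nanoword`
identifies the words, and `KinkInsertion.kinkPair` yields the geometric kink relation. What remains
are finite checks on integer lists, with isomorphism and pairing put in decidable form. -/

namespace CurveWords

/-! ### Closed lattice walks -/

/-- The lattice point `v` as a complex number. -/
def toC (v : ℤ × ℤ) : ℂ := ⟨v.1, v.2⟩

/-- The integer version of `cross`. -/
def det (u v : ℤ × ℤ) : ℤ := u.1 * v.2 - u.2 * v.1

/-- The scalar product of lattice vectors. -/
def dot (u v : ℤ × ℤ) : ℤ := u.1 * v.1 + u.2 * v.2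

@[simp] lemma toC_re (v : ℤ × ℤ) : (toC v).re = v.1 := rfl
@[simp] lemma toC_im (v : ℤ × ℤ) : (toC v).im = v.2 := rfl

lemma toC_injective : Function.Injective toC := by
  rintro ⟨a, b⟩ ⟨c, d⟩ h
  have h1 := congrArg Complex.re h
  have h2 := congrArg Complex.im h
  simp only [toC_re, toC_im, Int.cast_inj] at h1 h2
  rw [h1, h2]

lemma cross_toC (u v : ℤ × ℤ) : cross (toC u) (toC v) = det u v := by
  simp [cross, det]

/-- A closed lattice walk without backtracking that passes a vertex at most twice, and does
so only by two straight perpendicular passages. -/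
structure LatticeLoop where
  length : ℕ
  length_pos : 0 < length
  vertex : ℤ → ℤ × ℤ
  periodic : ∀ k, vertex (k + length) = vertex k
  unit_step : ∀ k, dot (vertex (k + 1) - vertex k) (vertex (k + 1) - vertex k) = 1
  no_backtrack : ∀ k, 0 ≤ dot (vertex k - vertex (k - 1)) (vertex (k + 1) - vertex k)
  crossing : ∀ k l, vertex k = vertex l → (length : ℤ) ∣ l - k ∨
    (vertex k - vertex (k - 1) = vertex (k + 1) - vertex k ∧
      vertex l - vertex (l - 1) = vertex (l + 1) - vertex l ∧
      det (vertex (k + 1) - vertex k) (vertex (l + 1) - vertex l) ≠ 0)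

lemma unit_cases {v : ℤ × ℤ} (h : dot v v = 1) :
    v = (1, 0) ∨ v = (-1, 0) ∨ v = (0, 1) ∨ v = (0, -1) := by
  obtain ⟨a, b⟩ := v
  simp only [dot] at h
  have ha : a ≤ 1 := by nlinarith
  have ha' : -1 ≤ a := by nlinarith
  have hb : b ≤ 1 := by nlinarith
  have hb' : -1 ≤ b := by nlinarith
  interval_cases a <;> interval_cases b <;> simp_all

/-! ### The cut-off profile that rounds a corner. -/

/-- Smooth transition from `0` to the identity. -/
noncomputable def ramp (u : ℝ) : ℝ := u * Real.smoothTransition (2 * u + 1 / 2)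

lemma ramp_of_le {u : ℝ} (h : u ≤ -(1 / 4)) : ramp u = 0 := by
  rw [ramp, Real.smoothTransition.zero_of_nonpos (by linarith), mul_zero]

lemma ramp_of_ge {u : ℝ} (h : 1 / 4 ≤ u) : ramp u = u := by
  rw [ramp, Real.smoothTransition.one_of_one_le (by linarith), mul_one]

lemma contDiff_ramp : ContDiff ℝ ∞ ramp := by
  unfold ramp
  exact contDiff_id.mul (Real.smoothTransition.contDiff.comp (by fun_prop))

lemma hasDerivAt_ramp (u : ℝ) : HasDerivAt ramp (deriv ramp u) u :=
  ((contDiff_ramp.differentiable (by simp)) u).hasDerivAt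

/-- `ramp u` is `u` times a factor in `[0, 1]`, so the two parts of `u` have the same sign. This
bounds the distance of a rounded corner from its vertex. -/
lemma abs_sub_ramp_add_abs_ramp (u : ℝ) : |u - ramp u| + |ramp u| = |u| := by
  have h0 := Real.smoothTransition.nonneg (2 * u + 1 / 2)
  have h1 := Real.smoothTransition.le_one (2 * u + 1 / 2)
  have e : u - ramp u = u * (1 - Real.smoothTransition (2 * u + 1 / 2)) := by rw [ramp]; ring
  rw [e, ramp, abs_mul, abs_mul, abs_of_nonneg h0, abs_of_nonneg (sub_nonneg.2 h1)]
  ring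

lemma deriv_ramp_of_lt {u : ℝ} (h : u < -(1 / 4)) : deriv ramp u = 0 := by
  have : ramp =ᶠ[nhds u] fun _ => 0 :=
    Filter.eventuallyEq_of_mem (Iio_mem_nhds h) fun x hx => ramp_of_le (le_of_lt hx)
  rw [this.deriv_eq]; simp

lemma deriv_ramp_of_gt {u : ℝ} (h : 1 / 4 < u) : deriv ramp u = 1 := by
  have : ramp =ᶠ[nhds u] fun x => x :=
    Filter.eventuallyEq_of_mem (Ioi_mem_nhds h) fun x hx => ramp_of_ge (le_of_lt hx)
  rw [this.deriv_eq]; simp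

/-! ### Smoothing a lattice walk. -/

namespace LatticeLoop

variable (G : LatticeLoop)

/-- The step from the `k`-th vertex to the next one. -/
def step (k : ℤ) : ℤ × ℤ := G.vertex (k + 1) - G.vertex k

lemma step_pred (k : ℤ) : G.step (k - 1) = G.vertex k - G.vertex (k - 1) := by
  simp [step]

lemma vertex_succ (k : ℤ) : G.vertex (k + 1) = G.vertex k + G.step k := by simp [step]

lemma step_unit (k : ℤ) : dot (G.step k) (G.step k) = 1 := G.unit_step k

lemma step_cases (k : ℤ) : G.step k = (1, 0) ∨ G.step k = (-1, 0) ∨ G.step k = (0, 1) ∨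
    G.step k = (0, -1) := unit_cases (G.step_unit k)

lemma dot_step_nonneg (k : ℤ) : 0 ≤ dot (G.step (k - 1)) (G.step k) := by
  rw [step_pred]; exact G.no_backtrack k

lemma eq_or_straight {k l : ℤ} (h : G.vertex k = G.vertex l) : (G.length : ℤ) ∣ l - k ∨
    (G.step (k - 1) = G.step k ∧ G.step (l - 1) = G.step l ∧ det (G.step k) (G.step l) ≠ 0) := by
  rw [step_pred, step_pred]; exact G.crossing k l h

lemma vertex_add_mul (k n : ℤ) : G.vertex (k + n * G.length) = G.vertex k := by
  have h : Function.Periodic G.vertex G.length := G.periodic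
  simpa using h.int_mul n k

lemma step_add_mul (k n : ℤ) : G.step (k + n * G.length) = G.step k := by
  rw [step, step, ← G.vertex_add_mul (k + 1) n, G.vertex_add_mul k n]
  congr 2; ring

/-- The pieces of the smoothed walk. -/
noncomputable def piece (k : ℤ) (t : ℝ) : ℂ :=
  toC (G.vertex k) + ((t - k - ramp (t - k) : ℝ) : ℂ) * toC (G.step (k - 1)) +
    ((ramp (t - k) : ℝ) : ℂ) * toC (G.step k)

/-- The smoothed walk. -/
noncomputable def path (t : ℝ) : ℂ := G.piece (round t) t

lemma toC_add (u v : ℤ × ℤ) : toC (u + v) = toC u + toC v := by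
  apply Complex.ext <;> simp

/-- In the middle half of an edge both neighbouring corner formulas reduce to the straight edge, so
the pieces glue. -/
lemma piece_succ {k : ℤ} {t : ℝ} (h1 : 1 / 4 ≤ t - k) (h2 : t - k ≤ 3 / 4) :
    G.piece (k + 1) t = G.piece k t := by
  have e : k + 1 - 1 = k := by ring
  have h3 : t - (k + 1 : ℤ) ≤ -(1 / 4) := by push_cast; linarith
  rw [piece, piece, ramp_of_ge h1, ramp_of_le h3, e, vertex_succ, toC_add]
  push_cast
  ring

/-- The radius `3 / 4` exceeds the rounding radius `1 / 2`. Hence every time, half-integers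
included, has a neighbourhood on which one smooth formula holds. -/
lemma path_eq_piece {k : ℤ} {t : ℝ} (h : |t - k| < 3 / 4) : G.path t = G.piece k t := by
  have hr := abs_sub_round t
  rw [abs_le] at hr
  rw [abs_lt] at h
  have h1 : ((round t : ℤ) : ℝ) < k + 2 := by linarith
  have h2 : (k : ℝ) - 2 < (round t : ℤ) := by linarith
  have h3 : round t < k + 2 := by exact_mod_cast h1
  have h4 : k - 2 < round t := by exact_mod_cast h2
  have : round t = k - 1 ∨ round t = k ∨ round t = k + 1 := by omega
  rcases this with e | e | e
  · rw [path, e]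
    rw [e] at hr
    push_cast at hr
    have := G.piece_succ (k := k - 1) (t := t) (by push_cast; linarith) (by push_cast; linarith)
    rw [← this]; simp
  · rw [path, e]
  · rw [path, e]
    rw [e] at hr
    push_cast at hr
    exact G.piece_succ (by linarith) (by linarith)

lemma contDiff_piece (k : ℤ) : ContDiff ℝ ∞ (G.piece k) := by
  have h : ContDiff ℝ ∞ (fun t : ℝ => ramp (t - k)) := contDiff_ramp.comp (by fun_prop)
  unfold piece
  have h1 : ContDiff ℝ ∞ (fun t : ℝ => ((ramp (t - k) : ℝ) : ℂ)) :=
    Complex.ofRealCLM.contDiff.comp h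
  have h2 : ContDiff ℝ ∞ (fun t : ℝ => ((t - k - ramp (t - k) : ℝ) : ℂ)) :=
    Complex.ofRealCLM.contDiff.comp (ContDiff.sub (by fun_prop) h)
  exact (contDiff_const.add (h2.mul contDiff_const)).add (h1.mul contDiff_const)

lemma path_eventuallyEq {k : ℤ} {t : ℝ} (h : |t - k| < 3 / 4) :
    G.path =ᶠ[nhds t] G.piece k := by
  have : {x : ℝ | |x - k| < 3 / 4} ∈ nhds t :=
    (isOpen_lt (by fun_prop) continuous_const).mem_nhds h
  exact Filter.eventuallyEq_of_mem this fun x hx => G.path_eq_piece hx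

lemma contDiff_path : ContDiff ℝ ∞ G.path := by
  rw [contDiff_iff_contDiffAt]
  intro t
  have h : |t - round t| < 3 / 4 := lt_of_le_of_lt (abs_sub_round t) (by norm_num)
  exact (G.contDiff_piece _).contDiffAt.congr_of_eventuallyEq (G.path_eventuallyEq h)

lemma hasDerivAt_path {k : ℤ} {t : ℝ} (h : |t - k| < 3 / 4) :
    HasDerivAt G.path (((1 - deriv ramp (t - k) : ℝ) : ℂ) * toC (G.step (k - 1)) +
      ((deriv ramp (t - k) : ℝ) : ℂ) * toC (G.step k)) t := by
  have h0 : HasDerivAt (fun x : ℝ => x - (k : ℝ)) 1 t := (hasDerivAt_id t).sub_const _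
  have h1 : HasDerivAt (fun x : ℝ => ramp (x - k)) (deriv ramp (t - k)) t := by
    have := (hasDerivAt_ramp (t - k)).scomp t h0
    rwa [one_smul] at this
  have h2 := (h0.sub h1).ofReal_comp.mul_const (toC (G.step (k - 1)))
  have h3 := h1.ofReal_comp.mul_const (toC (G.step k))
  have h4 := (h2.add h3).const_add (toC (G.vertex k))
  refine HasDerivAt.congr_of_eventuallyEq ?_ (G.path_eventuallyEq h)
  convert h4 using 1
  funext x
  simp [piece, add_assoc]

lemma deriv_path {k : ℤ} {t : ℝ} (h : |t - k| < 3 / 4) :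
    deriv G.path t = ((1 - deriv ramp (t - k) : ℝ) : ℂ) * toC (G.step (k - 1)) +
      ((deriv ramp (t - k) : ℝ) : ℂ) * toC (G.step k) := (G.hasDerivAt_path h).deriv

lemma path_add_mul (t : ℝ) (n : ℤ) : G.path (t + n * G.length) = G.path t := by
  have e : round (t + n * G.length) = round t + n * G.length := by
    have := round_add_intCast t (n * G.length)
    rw [← this]; push_cast; rfl
  have e2 : t + n * G.length - ((round t + n * G.length : ℤ) : ℝ) = t - round t := by
    push_cast; ring
  have e3 : round t + n * (G.length : ℤ) - 1 = round t - 1 + n * G.length := by ring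
  rw [path, path, e, piece, piece, e2, e3, vertex_add_mul, step_add_mul, step_add_mul]

/-- The scalar product with the sum of the two steps at the `k`-th vertex. -/
noncomputable def height (k : ℤ) (z : ℂ) : ℝ :=
  z.re * ((G.step (k - 1)).1 + (G.step k).1) + z.im * ((G.step (k - 1)).2 + (G.step k).2)

/-- Both unit steps at a vertex have the same scalar product with their sum, so only `a + b`
matters. This is needed because the derivative of `ramp` takes negative values and the velocity is
not a convex combination of the steps. Its coefficients still add up to `1`, and those of the
displacement to `t - k`, which gives immersion and injectivity of a piece once backtracking is
excluded. -/
lemma height_combination (k : ℤ) (a b : ℝ) :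
    G.height k ((a : ℂ) * toC (G.step (k - 1)) + (b : ℂ) * toC (G.step k)) =
      (a + b) * (1 + dot (G.step (k - 1)) (G.step k)) := by
  have h1 : (dot (G.step (k - 1)) (G.step (k - 1)) : ℝ) = 1 := by
    exact_mod_cast G.step_unit (k - 1)
  have h2 : (dot (G.step k) (G.step k) : ℝ) = 1 := by exact_mod_cast G.step_unit k
  simp only [dot] at h1 h2 ⊢
  push_cast at h1 h2 ⊢
  simp only [height, Complex.add_re, Complex.mul_re, Complex.ofReal_re, toC_re, Complex.ofReal_im,
    toC_im, zero_mul, sub_zero, Complex.add_im, Complex.mul_im, add_zero]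
  linear_combination a * h1 + b * h2

lemma one_add_dot_pos (k : ℤ) : (0 : ℝ) < 1 + dot (G.step (k - 1)) (G.step k) := by
  have : (0 : ℝ) ≤ dot (G.step (k - 1)) (G.step k) := by exact_mod_cast G.dot_step_nonneg k
  linarith

lemma deriv_path_ne_zero (t : ℝ) : deriv G.path t ≠ 0 := by
  have h : |t - round t| < 3 / 4 := lt_of_le_of_lt (abs_sub_round t) (by norm_num)
  intro h0
  have h1 := congrArg (G.height (round t)) (G.deriv_path h)
  rw [h0, height_combination] at h1
  have := G.one_add_dot_pos (round t)
  simp [height] at h1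
  linarith

lemma piece_injective (k : ℤ) : Function.Injective (G.piece k) := by
  intro s t h
  have e : ∀ x, G.height k (G.piece k x - toC (G.vertex k)) =
      (x - k) * (1 + dot (G.step (k - 1)) (G.step k)) := by
    intro x
    have : G.piece k x - toC (G.vertex k) =
      ((x - k - ramp (x - k) : ℝ) : ℂ) * toC (G.step (k - 1)) +
        ((ramp (x - k) : ℝ) : ℂ) * toC (G.step k) := by rw [piece]; ring
    rw [this, height_combination]; ring
  have h1 := e s
  rw [h, e t] at h1
  have := mul_right_cancel₀ (G.one_add_dot_pos k).ne' h1
  linarith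

/-- In the `ℓ¹` norm the point stays as close to the vertex as on the unrounded walk. Two passages
at rounding distance at most `1 / 2` can therefore meet only if their vertices are equal or
adjacent. -/
lemma piece_mem_cell (k : ℤ) (t : ℝ) :
    |(G.piece k t).re - (G.vertex k).1| + |(G.piece k t).im - (G.vertex k).2| ≤ |t - k| := by
  rw [← abs_sub_ramp_add_abs_ramp (t - k)]
  generalize e : t - (k : ℝ) = u
  have h1 : (G.piece k t).re - (G.vertex k).1 =
      (u - ramp u) * (G.step (k - 1)).1 + ramp u * (G.step k).1 := by
    simp [piece, e]; ring
  have h2 : (G.piece k t).im - (G.vertex k).2 =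
      (u - ramp u) * (G.step (k - 1)).2 + ramp u * (G.step k).2 := by
    simp [piece, e]; ring
  rw [h1, h2]
  generalize u - ramp u = a
  generalize ramp u = b
  have key : ∀ v : ℤ × ℤ, dot v v = 1 → |(v.1 : ℝ)| + |(v.2 : ℝ)| = 1 := by
    intro v hv
    rcases unit_cases hv with rfl | rfl | rfl | rfl <;> norm_num
  have k1 := key _ (G.step_unit (k - 1))
  have k2 := key _ (G.step_unit k)
  calc _ ≤ (|a| * |((G.step (k - 1)).1 : ℝ)| + |b| * |((G.step k).1 : ℝ)|) +
        (|a| * |((G.step (k - 1)).2 : ℝ)| + |b| * |((G.step k).2 : ℝ)|) := by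
        rw [← abs_mul, ← abs_mul, ← abs_mul, ← abs_mul]
        exact add_le_add (abs_add_le _ _) (abs_add_le _ _)
    _ = |a| * (|((G.step (k - 1)).1 : ℝ)| + |((G.step (k - 1)).2 : ℝ)|) +
        |b| * (|((G.step k).1 : ℝ)| + |((G.step k).2 : ℝ)|) := by ring
    _ = |a| + |b| := by rw [k1, k2]; ring

lemma piece_straight {k : ℤ} (h : G.step (k - 1) = G.step k) (t : ℝ) :
    G.piece k t = toC (G.vertex k) + ((t - k : ℝ) : ℂ) * toC (G.step k) := by
  rw [piece, h]; push_cast; ring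

lemma path_intCast (k : ℤ) : G.path k = toC (G.vertex k) := by
  rw [G.path_eq_piece (k := k) (by norm_num), piece]
  simp [ramp]

/-! ### Double points of a smoothed walk -/

lemma lattice_near {u v : ℤ × ℤ} {c : ℝ} (h : |(u.1 : ℝ) - v.1| + |(u.2 : ℝ) - v.2| ≤ c)
    (hc : c ≤ 1) : u = v ∨ (c = 1 ∧ dot (u - v) (u - v) = 1) := by
  have h1 : |u.1 - v.1| + |u.2 - v.2| ≤ 1 := by
    have : ((|u.1 - v.1| + |u.2 - v.2| : ℤ) : ℝ) ≤ 1 := by push_cast; linarith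
    exact_mod_cast this
  by_cases h2 : |u.1 - v.1| + |u.2 - v.2| = 1
  · right
    constructor
    · have : ((|u.1 - v.1| + |u.2 - v.2| : ℤ) : ℝ) = 1 := by exact_mod_cast h2
      push_cast at this
      linarith
    · simp only [dot, Prod.fst_sub, Prod.snd_sub]
      rcases abs_cases (u.1 - v.1) with ⟨e1, -⟩ | ⟨e1, -⟩ <;>
        rcases abs_cases (u.2 - v.2) with ⟨e2, -⟩ | ⟨e2, -⟩ <;>
        rw [← abs_mul_abs_self (u.1 - v.1), ← abs_mul_abs_self (u.2 - v.2)] <;>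
        have := abs_nonneg (u.1 - v.1) <;> have := abs_nonneg (u.2 - v.2) <;>
        have : |u.1 - v.1| = 0 ∨ |u.1 - v.1| = 1 := by omega
      all_goals
        rcases this with e | e
        · have e' : |u.2 - v.2| = 1 := by omega
          rw [e, e']; norm_num
        · have e' : |u.2 - v.2| = 0 := by omega
          rw [e, e']; norm_num
  · left
    have := abs_nonneg (u.1 - v.1)
    have := abs_nonneg (u.2 - v.2)
    have e1 : |u.1 - v.1| = 0 := by omega
    have e2 : |u.2 - v.2| = 0 := by omega
    rw [abs_eq_zero] at e1 e2
    exact Prod.ext (by omega) (by omega)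

/-- The hypotheses say that edge `l - 1` runs along edge `k - 1` backwards. If `l` and `k - 1` are
the same time up to periods, this is backtracking. Otherwise the common vertex is a straight
crossing, and the two directions there would be parallel. -/
lemma not_reversed_edge {k l : ℤ} (h1 : G.vertex (k - 1) = G.vertex l)
    (h2 : G.step (l - 1) = - G.step (k - 1)) : False := by
  have hu := G.step_unit (k - 1)
  rcases G.eq_or_straight h1 with ⟨n, hn⟩ | ⟨-, h3, h4⟩
  · have e : l - 1 = k - 1 - 1 + n * G.length := by linarith
    rw [e, step_add_mul] at h2
    have := G.dot_step_nonneg (k - 1)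
    rw [h2] at this
    simp only [dot, Prod.fst_neg, Prod.snd_neg] at this hu
    linarith
  · rw [← h3, h2] at h4
    apply h4
    simp only [det, Prod.fst_neg, Prod.snd_neg]
    ring

/-- The smoothed walk meets itself exactly where the lattice walk does: at integer times, with
transversal straight passages. -/
theorem path_eq {s t : ℝ} (h : G.path s = G.path t) :
    (∃ n : ℤ, t = s + n * G.length) ∨
      ∃ k l : ℤ, s = k ∧ t = l ∧ G.vertex k = G.vertex l ∧
        det (G.step k) (G.step l) ≠ 0 := by
  have hs := abs_sub_round s
  have ht := abs_sub_round t
  have hk : G.path s = G.piece (round s) s := rfl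
  have hl : G.path t = G.piece (round t) t := rfl
  -- Half-integers are rounded up, so the value `+1 / 2` never occurs. In the extremal case this
  -- fixes both offsets as `-1 / 2`.
  have ks : s - round s < 1 / 2 := by rw [round_eq]; linarith [Int.lt_floor_add_one (s + 1 / 2)]
  have kt : t - round t < 1 / 2 := by rw [round_eq]; linarith [Int.lt_floor_add_one (t + 1 / 2)]
  have h34 : |t - (round t : ℤ)| < 3 / 4 := lt_of_le_of_lt ht (by norm_num)
  generalize round s = k at *
  generalize round t = l at *
  have hcell : |((G.vertex k).1 : ℝ) - (G.vertex l).1| + |((G.vertex k).2 : ℝ) - (G.vertex l).2| ≤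
      |s - k| + |t - l| := by
    have c1 := G.piece_mem_cell k s
    have c2 := G.piece_mem_cell l t
    rw [← hk, h] at c1
    rw [← hl] at c2
    have t1 := abs_sub_le ((G.vertex k).1 : ℝ) (G.path t).re (G.vertex l).1
    have t2 := abs_sub_le ((G.vertex k).2 : ℝ) (G.path t).im (G.vertex l).2
    rw [abs_sub_comm] at c1
    rw [abs_sub_comm (G.path t).im] at c1
    linarith
  rcases lattice_near hcell (by linarith) with hv | ⟨hc, hd⟩
  · rcases G.eq_or_straight hv with ⟨n, hn⟩ | ⟨s1, s2, hdet⟩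
    · left
      refine ⟨n, ?_⟩
      have hn' : (l : ℝ) = k + n * G.length := by
        have : l = k + n * G.length := by linarith
        rw [this]; push_cast; ring
      have e1 : G.path t = G.path (t + (-n : ℤ) * G.length) := (G.path_add_mul t (-n)).symm
      have e2 : G.path (t + (-n : ℤ) * G.length) = G.piece k (t + (-n : ℤ) * G.length) := by
        apply G.path_eq_piece
        push_cast
        rw [show t + -(n : ℝ) * G.length - k = t - l by rw [hn']; ring]
        exact h34
      have := G.piece_injective k (hk.symm.trans (h.trans (e1.trans e2)))
      rw [this]; push_cast; ring
    · right
      -- Two non-parallel straight lines through the common vertex: the linear system has only the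
      -- solution `s = k`, `t = l`.
      rw [hk, hl, G.piece_straight s1, G.piece_straight s2, hv, add_right_inj] at h
      have h1 := congrArg Complex.re h
      have h2 := congrArg Complex.im h
      simp only [Complex.mul_re, Complex.ofReal_re, toC_re, Complex.ofReal_im, toC_im, zero_mul,
        sub_zero, Complex.mul_im, add_zero] at h1 h2
      have hD : (((G.step k).1 * (G.step l).2 - (G.step k).2 * (G.step l).1 : ℤ) : ℝ) ≠ 0 := by
        exact_mod_cast hdet
      push_cast at hD
      have r1 : (s - k) * ((G.step k).1 * (G.step l).2 - (G.step k).2 * (G.step l).1 : ℝ) = 0 := by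
        linear_combination (G.step l).2 * h1 - (G.step l).1 * h2
      have r2 : (t - l) * ((G.step k).1 * (G.step l).2 - (G.step k).2 * (G.step l).1 : ℝ) = 0 := by
        linear_combination (G.step k).2 * h1 - (G.step k).1 * h2
      have r1' := (mul_eq_zero.1 r1).resolve_right hD
      have r2' := (mul_eq_zero.1 r2).resolve_right hD
      exact ⟨k, l, by linarith, by linarith, hv, hdet⟩
  · exfalso
    -- Adjacent vertices force both points to be midpoints of the incoming edges. A common midpoint
    -- then means that the edges are opposite to each other.
    have a1 : |s - k| = 1 / 2 := by linarith
    have a2 : |t - l| = 1 / 2 := by linarith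
    have b1 : s - k = -(1 / 2) := by
      rcases abs_eq (by norm_num : (0 : ℝ) ≤ 1 / 2) |>.1 a1 with e | e <;> linarith
    have b2 : t - l = -(1 / 2) := by
      rcases abs_eq (by norm_num : (0 : ℝ) ≤ 1 / 2) |>.1 a2 with e | e <;> linarith
    rw [hk, hl, piece, piece, b1, b2, ramp_of_le (by norm_num)] at h
    have h1 := congrArg Complex.re h
    have h2 := congrArg Complex.im h
    simp at h1 h2
    have h1' : 2 * ((G.vertex k).1 - (G.vertex l).1) =
        (G.step (k - 1)).1 - (G.step (l - 1)).1 := by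
      have : (2 * ((G.vertex k).1 - (G.vertex l).1) : ℝ) =
        (G.step (k - 1)).1 - (G.step (l - 1)).1 := by linarith
      exact_mod_cast this
    have h2' : 2 * ((G.vertex k).2 - (G.vertex l).2) =
        (G.step (k - 1)).2 - (G.step (l - 1)).2 := by
      have : (2 * ((G.vertex k).2 - (G.vertex l).2) : ℝ) =
        (G.step (k - 1)).2 - (G.step (l - 1)).2 := by linarith
      exact_mod_cast this
    have e := G.step_pred k
    have u1 := unit_cases hd
    have : G.step (l - 1) = - G.step (k - 1) ∧ G.vertex k - G.vertex l = G.step (k - 1) := by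
      simp only [Prod.ext_iff, Prod.fst_sub, Prod.snd_sub, Prod.fst_neg, Prod.snd_neg] at u1 ⊢
      have d1 := G.step_cases (k - 1)
      have d2 := G.step_cases (l - 1)
      simp only [Prod.ext_iff] at d1 d2
      omega
    refine G.not_reversed_edge (k := k) (l := l) ?_ this.1
    have h3 := this.2
    rw [e] at h3
    exact (sub_right_injective h3).symm

/-! ### The closed curve of a lattice walk -/

lemma length_pos' : (0 : ℝ) < G.length := by exact_mod_cast G.length_pos

/-- The smoothed walk with mesh `h`, parametrized with period `1`. -/
noncomputable def param (h : ℝ) (t : ℝ) : ℂ := (h : ℂ) * G.path (G.length * t)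

lemma contDiff_param (h : ℝ) : ContDiff ℝ ∞ (G.param h) :=
  contDiff_const.mul (G.contDiff_path.comp (by fun_prop))

lemma hasDerivAt_path' (t : ℝ) : HasDerivAt G.path (deriv G.path t) t :=
  ((G.contDiff_path.differentiable (by simp)) t).hasDerivAt

lemma deriv_scaled (h c t : ℝ) : deriv (fun x : ℝ => (h : ℂ) * G.path (c * x)) t =
    ((h * c : ℝ) : ℂ) * deriv G.path (c * t) := by
  have h0 : HasDerivAt (fun x : ℝ => c * x) c t := by
    simpa using (hasDerivAt_id t).const_mul c
  have h1 := ((G.hasDerivAt_path' (c * t)).scomp t h0).const_mul (h : ℂ)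
  have h2 : HasDerivAt (fun x : ℝ => (h : ℂ) * G.path (c * x)) _ t := h1
  rw [h2.deriv, Complex.real_smul]
  push_cast
  ring

lemma deriv_param (h t : ℝ) :
    deriv (G.param h) t = ((h * G.length : ℝ) : ℂ) * deriv G.path (G.length * t) :=
  G.deriv_scaled h G.length t

lemma param_eq {h : ℝ} (hh : 0 < h) {s t : ℝ} (e : G.param h s = G.param h t)
    (ha : ∀ k : ℤ, t ≠ s + k) : ∃ k l : ℤ, G.length * s = k ∧ G.length * t = l ∧
      G.vertex k = G.vertex l ∧ det (G.step k) (G.step l) ≠ 0 := by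
  have hc : (h : ℂ) ≠ 0 := by exact_mod_cast hh.ne'
  rcases G.path_eq (mul_left_cancel₀ hc e) with ⟨n, hn⟩ | h
  · refine absurd ?_ (ha n)
    exact mul_left_cancel₀ G.length_pos'.ne' (by linarith)
  · exact h

/-- At a crossing both passages are straight, so rounding leaves the velocities equal to the steps.
-/
lemma deriv_path_intCast {k l : ℤ} (h1 : G.vertex k = G.vertex l)
    (h2 : det (G.step k) (G.step l) ≠ 0) :
    deriv G.path k = toC (G.step k) ∧ deriv G.path l = toC (G.step l) := by
  have hs : G.step (k - 1) = G.step k ∧ G.step (l - 1) = G.step l := by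
    rcases G.eq_or_straight h1 with ⟨n, hn⟩ | h
    · have e : l = k + n * G.length := by linarith
      rw [e, step_add_mul] at h2
      exact absurd (by simp only [det]; ring) h2
    · exact ⟨h.1, h.2.1⟩
  rw [G.deriv_path (k := k) (by norm_num), G.deriv_path (k := l) (by norm_num), hs.1, hs.2]
  constructor <;> push_cast <;> ring

lemma cross_mul_left (a b : ℝ) (u v : ℂ) : cross (a * u) (b * v) = a * b * cross u v := by
  simp [cross]; ring

lemma vertex_mem_image (k : ℤ) : G.vertex k ∈
    (Finset.range G.length).image (fun n : ℕ => G.vertex n) := by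
  have hN : (0 : ℤ) < G.length := by exact_mod_cast G.length_pos
  rw [Finset.mem_image]
  refine ⟨(k % G.length).toNat, ?_, ?_⟩
  · have := Int.emod_lt_of_pos k hN
    have := Int.emod_nonneg k hN.ne'
    rw [Finset.mem_range]; omega
  · rw [Int.toNat_of_nonneg (Int.emod_nonneg k hN.ne')]
    have := G.vertex_add_mul (k % G.length) (k / G.length)
    rw [← this, mul_comm, Int.emod_add_mul_ediv]

/-- The closed plane curve of a lattice walk, with mesh `h`. -/
noncomputable def curve (h : ℝ) (hh : 0 < h) : ClosedCurve where
  γ := fun _ => G.param h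
  smooth := fun _ => G.contDiff_param h
  periodic := by
    intro _ t
    have := G.path_add_mul (G.length * t) 1
    simp only [param]
    rw [← this]
    push_cast
    ring_nf
  immersed := by
    intro _ t
    rw [deriv_param]
    refine mul_ne_zero ?_ (G.deriv_path_ne_zero _)
    exact_mod_cast (mul_pos hh G.length_pos').ne'
  transversal := by
    rintro ⟨i, s⟩ ⟨j, t⟩ ha e
    have ha' := ha.resolve_left (fun h => h (Subsingleton.elim _ _))
    obtain ⟨k, l, hk, hl, h1, h2⟩ := G.param_eq hh e ha'
    have hd := G.deriv_path_intCast h1 h2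
    simp only [deriv_param, hk, hl, hd.1, hd.2, cross_mul_left, cross_toC]
    have := (mul_pos hh G.length_pos').ne'
    exact mul_ne_zero (mul_ne_zero this this) (by exact_mod_cast h2)
  no_triple := by
    rintro ⟨i, r⟩ ⟨j, s⟩ ⟨_, t⟩ ha hb hc ⟨e1, e2⟩
    have ha' := ha.resolve_left (fun h => h (Subsingleton.elim _ _))
    have hb' := hb.resolve_left (fun h => h (Subsingleton.elim _ _))
    have hc' := hc.resolve_left (fun h => h (Subsingleton.elim _ _))
    obtain ⟨k, l, hk, hl, -, h1⟩ := G.param_eq hh e1 ha'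
    obtain ⟨l', m, hl', hm, -, h2⟩ := G.param_eq hh e2 hb'
    obtain ⟨k', m', hk', hm', -, h3⟩ := G.param_eq hh (e1.trans e2) hc'
    have e1 : l' = l := by exact_mod_cast hl'.symm.trans hl
    have e2 : k' = k := by exact_mod_cast hk'.symm.trans hk
    have e3 : m' = m := by exact_mod_cast hm'.symm.trans hm
    subst e1 e2 e3
    -- A triple point would need three pairwise non-parallel lattice directions, but there are only
    -- two axes.
    rcases G.step_cases k' with e | e | e | e <;> rcases G.step_cases l' with e' | e' | e' | e' <;>
      rcases G.step_cases m' with e'' | e'' | e'' | e'' <;>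
      simp [e, e', e'', det] at h1 h2 h3
  finite_double := by
    refine Set.Finite.subset (((Finset.range G.length).image (fun n : ℕ => G.vertex n)).image
      (fun v => (h : ℂ) * toC v)).finite_toSet ?_
    rintro z ⟨⟨i, s⟩, ⟨j, t⟩, ha, rfl, e⟩
    have ha' := ha.resolve_left (fun h => h (Subsingleton.elim _ _))
    obtain ⟨k, l, hk, hl, h1, h2⟩ := G.param_eq hh e.symm ha'
    rw [Finset.mem_coe, Finset.mem_image]
    refine ⟨G.vertex k, G.vertex_mem_image k, ?_⟩
    simp only [param, hk, path_intCast]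

/-! ### The index of a smoothed walk -/

lemma contDiff_deriv {f : ℝ → ℂ} (hf : ContDiff ℝ ∞ f) : ContDiff ℝ ∞ (deriv f) :=
  (contDiff_infty_iff_deriv.1 hf).2

lemma toC_step_ne_zero (k : ℤ) : toC (G.step k) ≠ 0 := by
  rcases G.step_cases k with e | e | e | e <;> rw [e] <;> simp [toC, Complex.ext_iff]

/-- Divided by the incoming step, the velocity near the vertex is `(1 - β) + β w` with `w` equal to
`1`, `i` or `-i`. It never meets the closed negative real axis, since for `w = ±i` its imaginary
part vanishes only when its value is `1`. The principal logarithm thus measures the change of angle,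
which is the argument of `w`. -/
lemma integral_turn (k : ℤ) :
    ∫ t in ((k : ℝ) - 1 / 2)..(k + 1 / 2), (deriv (deriv G.path) t / deriv G.path t).im =
      det (G.step (k - 1)) (G.step k) * (Real.pi / 2) := by
  set D := toC (G.step (k - 1)) with hD
  have hD0 : D ≠ 0 := G.toC_step_ne_zero _
  have hcd := contDiff_deriv G.contDiff_path
  have hw : ∃ w : ℂ, toC (G.step k) = D * w ∧ (w = 1 ∨ w.im ≠ 0) ∧
      (Complex.log w).im = det (G.step (k - 1)) (G.step k) * (Real.pi / 2) := by
    have h0 := G.dot_step_nonneg k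
    have key : det (G.step (k - 1)) (G.step k) = 0 ∧ toC (G.step k) = D * 1 ∨
        det (G.step (k - 1)) (G.step k) = 1 ∧ toC (G.step k) = D * Complex.I ∨
        det (G.step (k - 1)) (G.step k) = -1 ∧ toC (G.step k) = D * -Complex.I := by
      rw [hD]
      rcases G.step_cases (k - 1) with e | e | e | e <;>
        rcases G.step_cases k with e' | e' | e' | e' <;>
        simp [e, e', det, dot, toC, Complex.ext_iff] at h0 ⊢
    rcases key with ⟨e, e'⟩ | ⟨e, e'⟩ | ⟨e, e'⟩
    · exact ⟨1, e', Or.inl rfl, by simp [e]⟩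
    · exact ⟨Complex.I, e', Or.inr (by simp), by rw [e, Complex.log_I]; simp⟩
    · refine ⟨-Complex.I, e', Or.inr (by simp), ?_⟩
      rw [e, Complex.log_neg_I]; simp
  obtain ⟨w, hDw, hw, hlog⟩ := hw
  have hV : ∀ t ∈ Set.uIcc ((k : ℝ) - 1 / 2) (k + 1 / 2),
      deriv G.path t / D ∈ Complex.slitPlane := by
    intro t ht
    rw [Set.uIcc_of_le (by linarith)] at ht
    have ht' : |t - k| < 3 / 4 := by rw [abs_lt]; constructor <;> linarith [ht.1, ht.2]
    rw [G.deriv_path ht', hDw]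
    have e : (((1 - deriv ramp (t - k) : ℝ) : ℂ) * D + ((deriv ramp (t - k) : ℝ) : ℂ) * (D * w)) / D
        = ((1 - deriv ramp (t - k) : ℝ) : ℂ) + ((deriv ramp (t - k) : ℝ) : ℂ) * w := by
      field_simp
    rw [← hD, e]
    rcases hw with rfl | hw
    · rw [Complex.mem_slitPlane_iff]; left; simp
    · by_cases hb : deriv ramp (t - k) = 0
      · rw [hb, Complex.mem_slitPlane_iff]; left; simp
      · rw [Complex.mem_slitPlane_iff]; right; simp [hb, hw]
  have hderiv : ∀ t ∈ Set.uIcc ((k : ℝ) - 1 / 2) (k + 1 / 2),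
      HasDerivAt (fun x => (Complex.log (deriv G.path x / D)).im)
        (deriv (deriv G.path) t / deriv G.path t).im t := by
    intro t ht
    have h1 : HasDerivAt (deriv G.path) (deriv (deriv G.path) t) t :=
      ((hcd.differentiable (by simp)) t).hasDerivAt
    have h2 := (h1.div_const D).clog_real (hV t ht)
    have h3 := Complex.imCLM.hasFDerivAt.comp_hasDerivAt t h2
    have e : deriv (deriv G.path) t / D / (deriv G.path t / D) =
        deriv (deriv G.path) t / deriv G.path t := by
      have := G.deriv_path_ne_zero t
      field_simp
    rw [e] at h3
    exact h3
  have hcont : Continuous fun t => (deriv (deriv G.path) t / deriv G.path t).im :=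
    Complex.continuous_im.comp (((contDiff_deriv hcd).continuous).div hcd.continuous
      G.deriv_path_ne_zero)
  rw [intervalIntegral.integral_eq_sub_of_hasDerivAt hderiv (hcont.intervalIntegrable _ _),
    G.deriv_path (k := k) (t := k + 1 / 2) (by rw [abs_lt]; constructor <;> linarith),
    G.deriv_path (k := k) (t := k - 1 / 2) (by rw [abs_lt]; constructor <;> linarith),
    deriv_ramp_of_gt (by linarith), deriv_ramp_of_lt (by linarith), hDw]
  simp only [sub_self, Complex.ofReal_zero, zero_mul, zero_add, Complex.ofReal_one, one_mul,
    sub_zero, add_zero, ← hD, div_self hD0, Complex.log_one, Complex.zero_im,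
    mul_div_cancel_left₀ _ hD0, hlog]

theorem index_curve (h : ℝ) (hh : 0 < h) : (G.curve h hh).index =
    ((∑ k ∈ Finset.range G.length, det (G.step (k - 1)) (G.step k) : ℤ) : ℝ) / 4 := by
  have hc : ((h * G.length : ℝ) : ℂ) ≠ 0 := by exact_mod_cast (mul_pos hh G.length_pos').ne'
  have hcd := contDiff_deriv G.contDiff_path
  have hcont : Continuous fun t => (deriv (deriv G.path) t / deriv G.path t).im :=
    Complex.continuous_im.comp (((contDiff_deriv hcd).continuous).div hcd.continuous
      G.deriv_path_ne_zero)
  have e1 : ∀ t, (deriv (deriv (G.curve h hh).param) t / deriv (G.curve h hh).param t).im =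
      G.length * (deriv (deriv G.path) (G.length * t) / deriv G.path (G.length * t)).im := by
    intro t
    have e : deriv (G.curve h hh).param =
        fun x => ((h * G.length : ℝ) : ℂ) * deriv G.path (G.length * x) :=
      funext (G.deriv_param h)
    have h0 : HasDerivAt (fun x : ℝ => (G.length : ℝ) * x) G.length t := by
      simpa using (hasDerivAt_id t).const_mul (G.length : ℝ)
    have h1 : HasDerivAt (deriv G.path) (deriv (deriv G.path) (G.length * t)) (G.length * t) :=
      ((hcd.differentiable (by simp)) _).hasDerivAt
    have h2 := (h1.scomp t h0).const_mul ((h * G.length : ℝ) : ℂ)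
    have h3 : HasDerivAt (fun x => ((h * G.length : ℝ) : ℂ) * deriv G.path (G.length * x)) _ t := h2
    rw [e, h3.deriv, mul_div_mul_left _ _ hc, Complex.real_smul, mul_div_assoc, Complex.im_ofReal_mul]
  have per : Function.Periodic (fun t => (deriv (deriv G.path) t / deriv G.path t).im)
      (G.length : ℝ) := by
    have p0 : Function.Periodic G.path G.length := fun t => by simpa using G.path_add_mul t 1
    have pd : ∀ f : ℝ → ℂ, Function.Periodic f G.length → Function.Periodic (deriv f) G.length := by
      intro f hf t
      have := deriv_comp_add_const f (G.length : ℝ) t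
      rw [← this]
      congr 1
      exact funext hf
    intro t
    simp only [pd _ p0 t, pd _ (pd _ p0) t]
  have e2 : ∫ t in (0 : ℝ)..G.length, (deriv (deriv G.path) t / deriv G.path t).im =
      ∑ k ∈ Finset.range G.length, det (G.step (k - 1)) (G.step k) * (Real.pi / 2) := by
    -- Shifting the period by half a step makes every corner lie inside one of the unit intervals.
    have := per.intervalIntegral_add_eq 0 (-(1 / 2))
    rw [zero_add] at this
    rw [this]
    have h1 := intervalIntegral.sum_integral_adjacent_intervals (μ := MeasureTheory.volume)
      (f := fun t => (deriv (deriv G.path) t / deriv G.path t).im)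
      (a := fun n : ℕ => (n : ℝ) - 1 / 2) (n := G.length)
      (fun k _ => hcont.intervalIntegrable _ _)
    rw [show (-(1 / 2) : ℝ) = ((0 : ℕ) : ℝ) - 1 / 2 by norm_num,
      show ((0 : ℕ) : ℝ) - 1 / 2 + G.length = (G.length : ℝ) - 1 / 2 by norm_num; ring, ← h1]
    refine Finset.sum_congr rfl fun k _ => ?_
    have := G.integral_turn k
    rw [← this]
    congr 1
    push_cast; ring
  rw [ClosedCurve.index]
  simp only [e1]
  have e3 := intervalIntegral.mul_integral_comp_mul_left (a := 0) (b := 1)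
    (f := fun t => (deriv (deriv G.path) t / deriv G.path t).im) (G.length : ℝ)
  rw [mul_zero, mul_one, e2, ← Finset.sum_mul] at e3
  rw [intervalIntegral.integral_const_mul, e3]
  push_cast
  have := Real.pi_ne_zero
  field_simp
  ring

/-! ### The nanowords of a smoothed walk -/

/-- `S` lists the vertices that the walk passes twice. -/
def IsCrossingList (S : List (ℤ × ℤ)) : Prop :=
  ∀ k, G.vertex k ∈ S ↔ ∃ l, G.vertex l = G.vertex k ∧ ¬ (G.length : ℤ) ∣ l - k

/-- The times in `[m, m + length)` at which the walk passes a vertex in `S`. -/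
def passages (S : List (ℤ × ℤ)) (m : ℤ) : List ℤ :=
  ((List.range G.length).map fun n : ℕ => m + (n : ℤ)).filter fun k => decide (G.vertex k ∈ S)

/-- The nanoword of the walk started at time `m`. -/
def walkWord (S : List (ℤ × ℤ)) (m : ℤ) : Nanoword (ℤ × ℤ) where
  word := (G.passages S m).map G.vertex
  sign := fun v =>
    match (G.passages S m).filter fun k => decide (G.vertex k = v) with
    | [k, l] => if 0 < det (G.step l) (G.step k) then 1 else -1
    | _ => 0

variable {G} {S : List (ℤ × ℤ)}

lemma mem_passages {m k : ℤ} :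
    k ∈ G.passages S m ↔ (m ≤ k ∧ k < m + G.length) ∧ G.vertex k ∈ S := by
  rw [passages, List.mem_filter, List.mem_map, decide_eq_true_iff]
  refine and_congr_left fun _ => ⟨?_, ?_⟩
  · rintro ⟨n, hn, rfl⟩
    rw [List.mem_range] at hn
    omega
  · intro h
    exact ⟨(k - m).toNat, by rw [List.mem_range]; omega, by omega⟩

lemma pairwise_passages (m : ℤ) : (G.passages S m).Pairwise (· < ·) := by
  refine List.Pairwise.filter _ (List.pairwise_map.2 ?_)
  exact List.pairwise_lt_range.imp (by intro a b h; omega)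

/-- Only finitely many starting times need to be examined when the base point is arbitrary. -/
lemma walkWord_add_mul (m n : ℤ) : G.walkWord S (m + n * G.length) = G.walkWord S m := by
  have e : G.passages S (m + n * G.length) =
      (G.passages S m).map (fun k => k + n * G.length) := by
    simp only [passages, List.filter_map, List.map_map]
    congr 1
    · funext j; simp only [Function.comp]; ring
    · refine List.filter_congr fun j _ => ?_
      simp only [Function.comp]
      rw [decide_eq_decide, show m + n * (G.length : ℤ) + j = m + j + n * G.length by ring,
        vertex_add_mul]
  have e1 : (G.vertex ∘ fun k => k + n * (G.length : ℤ)) = G.vertex :=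
    funext fun k => G.vertex_add_mul k n
  unfold walkWord
  rw [e, List.map_map, e1]
  congr 1
  funext v
  rw [List.filter_map]
  have e2 : ((fun k => decide (G.vertex k = v)) ∘ fun k => k + n * (G.length : ℤ)) =
      fun k => decide (G.vertex k = v) := by
    funext k; simp only [Function.comp, vertex_add_mul]
  rw [e2]
  generalize List.filter (fun k => decide (G.vertex k = v)) (G.passages S m) = L
  rcases L with _ | ⟨a, _ | ⟨b, _ | ⟨c, L⟩⟩⟩ <;> simp [step_add_mul]

lemma eq_of_dvd_of_mem {m k l : ℤ} (hk : m ≤ k ∧ k < m + G.length)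
    (hl : m ≤ l ∧ l < m + G.length) (h : (G.length : ℤ) ∣ l - k) : k = l := by
  have := Int.eq_zero_of_abs_lt_dvd h (by rw [abs_lt]; constructor <;> linarith [hk.1, hk.2, hl.1, hl.2])
  linarith

lemma param_div (h : ℝ) (k : ℤ) :
    G.param h ((k : ℝ) / G.length) = (h : ℂ) * toC (G.vertex k) := by
  rw [param, mul_div_cancel₀ _ G.length_pos'.ne', path_intCast]

lemma exists_partner (hS : G.IsCrossingList S) {m k : ℤ} (hk : k ∈ G.passages S m) :
    ∃ l, (m ≤ l ∧ l < m + G.length) ∧ l ≠ k ∧ G.vertex l = G.vertex k := by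
  rw [mem_passages] at hk
  obtain ⟨l, hl, hd⟩ := (hS k).1 hk.2
  have hN : (0 : ℤ) < G.length := by exact_mod_cast G.length_pos
  have h1 := Int.emod_add_mul_ediv (l - m) G.length
  have e : l = m + (l - m) % G.length + (l - m) / G.length * G.length := by linarith
  refine ⟨m + (l - m) % G.length, ⟨?_, ?_⟩, ?_, ?_⟩
  · linarith [Int.emod_nonneg (l - m) hN.ne']
  · linarith [Int.emod_lt_of_pos (l - m) hN]
  · intro h
    rw [h] at e
    exact hd ⟨(l - m) / G.length, by linarith⟩
  · rw [← hl, ← G.vertex_add_mul (m + (l - m) % G.length) ((l - m) / G.length), ← e]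

/-- The integer `⌊G.length * b⌋ + 1` is the first integer time strictly after the base point. -/
lemma mem_doubleParams (hS : G.IsCrossingList S) {h : ℝ} (hh : 0 < h) {b : ℝ}
    (hb : (G.curve h hh).IsBasePoint b) (s : ℝ) :
    s ∈ (G.curve h hh).doubleParams b ↔
      ∃ k ∈ G.passages S (⌊G.length * b⌋ + 1), (k : ℝ) / G.length = s := by
  have hN := G.length_pos'
  set m := ⌊G.length * b⌋ + 1 with hm
  have hm1 : ((m : ℤ) : ℝ) ≤ G.length * b + 1 := by
    rw [hm]; push_cast; linarith [Int.floor_le (G.length * b)]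
  have hm2 : G.length * b < m := by
    rw [hm]; push_cast; exact Int.lt_floor_add_one _
  constructor
  · rintro ⟨⟨hs1, hs2⟩, t, ⟨ht1, ht2⟩, hne, e⟩
    have ha : ∀ k : ℤ, t ≠ s + k := by
      intro k hk
      have h1 : (k : ℝ) < 1 := by linarith
      have h2 : (-1 : ℝ) < k := by linarith
      have h3 : k < 1 := by exact_mod_cast h1
      have h4 : -1 < k := by exact_mod_cast h2
      have h5 : k = 0 := by omega
      rw [h5] at hk
      exact hne (by simpa using hk)
    obtain ⟨k, l, hk, hl, hv, -⟩ := G.param_eq hh e.symm ha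
    refine ⟨k, mem_passages.2 ⟨⟨?_, ?_⟩, (hS k).2 ⟨l, hv.symm, ?_⟩⟩, ?_⟩
    · rw [hm, Int.add_one_le_iff, Int.floor_lt, ← hk]
      exact mul_lt_mul_of_pos_left hs1 hN
    · have h1 : (k : ℝ) < m + G.length := by
        rw [← hk]
        have := mul_lt_mul_of_pos_left hs2 hN
        linarith
      exact_mod_cast h1
    · rintro ⟨n, hn⟩
      refine ha n (mul_left_cancel₀ hN.ne' ?_)
      rw [hl, mul_add, hk]
      have : l = k + G.length * n := by linarith
      rw [this]; push_cast; ring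
    · rw [← hk, mul_div_cancel_left₀ _ hN.ne']
  · rintro ⟨k, hk, rfl⟩
    obtain ⟨l, hl, hlk, hv⟩ := exists_partner hS hk
    have hkm := (mem_passages.1 hk).1
    have hp : G.param h ((l : ℝ) / G.length) = G.param h ((k : ℝ) / G.length) := by
      rw [param_div, param_div, hv]
    have inner : ∀ i j : ℤ, (m ≤ i ∧ i < m + G.length) → (m ≤ j ∧ j < m + G.length) → i ≠ j →
        G.param h ((j : ℝ) / G.length) = G.param h ((i : ℝ) / G.length) →
        (i : ℝ) / G.length ∈ Set.Ioo b (b + 1) := by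
      intro i j hi hj hij he
      have hi1 : (m : ℝ) ≤ i := by exact_mod_cast hi.1
      have hi2 : (i : ℝ) + 1 ≤ m + G.length := by exact_mod_cast hi.2
      refine ⟨by rw [lt_div_iff₀ hN]; linarith, ?_⟩
      rw [div_lt_iff₀ hN]
      -- If `G.length * b` is an integer, the last integer time of the window is the base point
      -- again. A passage there with a different partner would make the base point a double point.
      refine lt_of_le_of_ne (by linarith) fun heq => ?_
      have hbi : (i : ℝ) / G.length = b + 1 := by
        rw [div_eq_iff hN.ne']; exact heq
      have hper := (G.curve h hh).periodic 0 b
      rw [hbi] at he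
      obtain ⟨n, hn⟩ := hb ((j : ℝ) / G.length) (he.trans hper)
      rw [div_eq_iff hN.ne'] at hn
      apply hij
      refine eq_of_dvd_of_mem hi hj ⟨n - 1, ?_⟩
      have : ((j - i : ℤ) : ℝ) = ((G.length * (n - 1) : ℤ) : ℝ) := by
        push_cast; rw [hn, heq]; ring
      exact_mod_cast this
    refine ⟨inner k l hkm hl hlk.symm hp, (l : ℝ) / G.length,
      inner l k hl hkm hlk hp.symm, ?_, hp⟩
    intro e
    apply hlk
    have := (div_left_inj' hN.ne').1 e
    exact_mod_cast this

lemma sort_doubleParams (hS : G.IsCrossingList S) {h : ℝ} (hh : 0 < h) {b : ℝ}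
    (hb : (G.curve h hh).IsBasePoint b) :
    ((G.curve h hh).doubleParams_finite b).toFinset.sort =
      (G.passages S (⌊G.length * b⌋ + 1)).map (fun k : ℤ => (k : ℝ) / G.length) := by
  classical
  have hN := G.length_pos'
  have hp : ((G.passages S (⌊G.length * b⌋ + 1)).map
      (fun k : ℤ => (k : ℝ) / G.length)).Pairwise (· < ·) := by
    rw [List.pairwise_map]
    refine (pairwise_passages _).imp fun {i j} hij => ?_
    have : (i : ℝ) < j := by exact_mod_cast hij
    exact div_lt_div_of_pos_right this hN
  have e : ((G.curve h hh).doubleParams_finite b).toFinset =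
      ((G.passages S (⌊G.length * b⌋ + 1)).map (fun k : ℤ => (k : ℝ) / G.length)).toFinset := by
    ext s
    rw [Set.Finite.mem_toFinset, mem_doubleParams hS hh hb, List.mem_toFinset, List.mem_map]
  rw [e]
  exact (List.toFinset_sort _ (hp.imp fun h => ne_of_lt h)).2 (hp.imp fun h => le_of_lt h)

/-- Letters correspond by scaling the vertices. Signs agree because at a double point the velocities
are equal positive multiples of the steps; if a letter does not have exactly two passages, both
signs take the default value `0`. -/
theorem iso_nanoword (hS : G.IsCrossingList S) {h : ℝ} (hh : 0 < h) {b : ℝ}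
    (hb : (G.curve h hh).IsBasePoint b) :
    (G.walkWord S (⌊G.length * b⌋ + 1)).Iso ((G.curve h hh).nanoword b) := by
  have hN := G.length_pos'
  have hc : (h : ℂ) ≠ 0 := by exact_mod_cast hh.ne'
  have hinj : Function.Injective fun v : ℤ × ℤ => (h : ℂ) * toC v :=
    fun u v e => toC_injective (mul_left_cancel₀ hc e)
  refine ⟨fun v => (h : ℂ) * toC v, hinj.injOn, ?_, ?_⟩
  · simp only [ClosedCurve.nanoword, walkWord]
    rw [sort_doubleParams hS hh hb, List.map_map, List.map_map]
    refine List.map_congr_left fun k _ => ?_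
    exact param_div h k
  · intro v _
    simp only [ClosedCurve.nanoword, walkWord]
    rw [sort_doubleParams hS hh hb, List.filter_map]
    have e : (G.passages S (⌊G.length * b⌋ + 1)).filter
        ((fun t => @decide ((G.curve h hh).param t = (h : ℂ) * toC v)
          (Classical.propDecidable _)) ∘ fun k : ℤ => (k : ℝ) / G.length) =
        (G.passages S (⌊G.length * b⌋ + 1)).filter fun k => decide (G.vertex k = v) := by
      refine List.filter_congr fun k _ => ?_
      simp only [Function.comp]
      rw [decide_eq_decide]
      have : (G.curve h hh).param ((k : ℝ) / G.length) = _ := param_div h k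
      rw [this]
      exact hinj.eq_iff
    rw [e]
    have hsub : ∀ k ∈ (G.passages S (⌊G.length * b⌋ + 1)).filter fun k => decide (G.vertex k = v),
        k ∈ G.passages S (⌊G.length * b⌋ + 1) ∧ G.vertex k = v := by
      intro k hk
      rw [List.mem_filter, decide_eq_true_iff] at hk
      exact hk
    have hpw := (pairwise_passages (G := G) (S := S) (⌊G.length * b⌋ + 1)).filter
      fun k => decide (G.vertex k = v)
    generalize (G.passages S (⌊G.length * b⌋ + 1)).filter (fun k => decide (G.vertex k = v)) = L
      at hsub hpw
    rcases L with _ | ⟨k, _ | ⟨l, _ | ⟨c, L⟩⟩⟩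
    · rfl
    · rfl
    · have hk := hsub k (by simp)
      have hl := hsub l (by simp)
      have hkl : k < l := by simpa using hpw
      have hv : G.vertex k = G.vertex l := hk.2.trans hl.2.symm
      have hdet : det (G.step k) (G.step l) ≠ 0 := by
        rcases G.eq_or_straight hv with hd | hd
        · exact absurd (eq_of_dvd_of_mem (mem_passages.1 hk.1).1 (mem_passages.1 hl.1).1 hd)
            hkl.ne
        · exact hd.2.2
      have hd := G.deriv_path_intCast hv hdet
      simp only [List.map_cons, List.map_nil]
      have e1 : ∀ j : ℤ, deriv (G.curve h hh).param ((j : ℝ) / G.length) =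
          ((h * G.length : ℝ) : ℂ) * deriv G.path j := by
        intro j
        have := G.deriv_param h ((j : ℝ) / G.length)
        rw [mul_div_cancel₀ _ hN.ne'] at this
        exact this
      rw [e1, e1, hd.1, hd.2, cross_mul_left, cross_toC]
      have hpos : 0 < h * G.length * (h * G.length) := by positivity
      have : 0 < h * G.length * (h * G.length) * (det (G.step l) (G.step k) : ℝ) ↔
          0 < det (G.step l) (G.step k) := by
        rw [mul_pos_iff_of_pos_left hpos]
        exact_mod_cast Iff.rfl
      simp only [this]
    · rfl

lemma isBasePoint_of_notMem_int {h : ℝ} (hh : 0 < h) {b : ℝ} (hb : ∀ k : ℤ, G.length * b ≠ k) :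
    (G.curve h hh).IsBasePoint b := by
  intro t ht
  by_contra! hne
  obtain ⟨k, -, hk, -⟩ := G.param_eq hh (Eq.symm ht) hne
  exact hb k hk

theorem exists_basePoint (hS : G.IsCrossingList S) {h : ℝ} (hh : 0 < h) (m : ℤ) :
    ∃ b, (G.curve h hh).IsBasePoint b ∧ (G.walkWord S m).Iso ((G.curve h hh).nanoword b) := by
  have hN := G.length_pos'
  -- The base point sits at a half-integer time just before `m`, which no double point can occupy.
  have e : G.length * ((m - 1 / 2) / G.length) = (m : ℝ) - 1 / 2 := by
    rw [mul_div_cancel₀ _ hN.ne']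
  have hb : (G.curve h hh).IsBasePoint (((m : ℝ) - 1 / 2) / G.length) := by
    refine isBasePoint_of_notMem_int hh fun k hk => ?_
    rw [e] at hk
    have h2 : ((2 * m - 1 : ℤ) : ℝ) = ((2 * k : ℤ) : ℝ) := by push_cast; linarith
    have h3 : 2 * m - 1 = 2 * k := by exact_mod_cast h2
    omega
  refine ⟨_, hb, ?_⟩
  have := iso_nanoword hS hh hb
  rw [e] at this
  have hf : ⌊(m : ℝ) - 1 / 2⌋ + 1 = m := by
    have : ⌊(m : ℝ) - 1 / 2⌋ = m - 1 := by
      rw [Int.floor_eq_iff]; push_cast; constructor <;> linarith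
    rw [this]; ring
  rwa [hf] at this

end LatticeLoop

/-! ### Isomorphisms of words and the pairing, in decidable form -/

/-- The words `v` and `v'` have the same length and the same coincidences of letters. -/
def SamePattern {α β : Type} (v : List α) (v' : List β) : Prop :=
  v.length = v'.length ∧ ∀ p ∈ v.zip v', ∀ q ∈ v.zip v', (p.1 = q.1 ↔ p.2 = q.2)

instance {α β : Type} [DecidableEq α] [DecidableEq β] (v : List α) (v' : List β) :
    Decidable (SamePattern v v') := inferInstanceAs (Decidable (_ ∧ _))

lemma SamePattern.exists_map {α β : Type} [Nonempty β] {v : List α} {v' : List β}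
    (h : SamePattern v v') : ∃ f : α → β, Set.InjOn f {a | a ∈ v} ∧ v' = v.map f ∧
      ∀ a ∈ v, (a, f a) ∈ v.zip v' := by
  classical
  have hex : ∀ a ∈ v, ∃ b, (a, b) ∈ v.zip v' := by
    intro a ha
    obtain ⟨i, hi, rfl⟩ := List.getElem_of_mem ha
    have hi' : i < v'.length := h.1 ▸ hi
    refine ⟨v'[i], ?_⟩
    have : (v.zip v')[i]'(by simp [hi, hi']) = (v[i], v'[i]) := by simp
    rw [← this]
    exact List.getElem_mem _
  let f : α → β := fun a => if ha : a ∈ v then (hex a ha).choose else Classical.arbitrary β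
  have hf : ∀ a ∈ v, (a, f a) ∈ v.zip v' := by
    intro a ha
    simp only [f, dif_pos ha]
    exact (hex a ha).choose_spec
  refine ⟨f, ?_, ?_, hf⟩
  · intro a ha b hb e
    exact (h.2 _ (hf a ha) _ (hf b hb)).2 e
  · refine List.ext_getElem (by simp [h.1]) fun i hi' hi => ?_
    have hi2 : i < v.length := by simpa using hi
    have hz : (v[i], v'[i]) ∈ v.zip v' := by
      have : (v.zip v')[i]'(by simp [hi2, hi']) = (v[i], v'[i]) := by simp
      rw [← this]
      exact List.getElem_mem _
    rw [List.getElem_map]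
    exact (h.2 _ hz _ (hf _ (List.getElem_mem hi2))).1 rfl

/-- This trades the search for a renaming for a finite comparison of coincidences of letters. -/
lemma wordIso_iff {α β : Type} [Nonempty β] {v : List α} {v' : List β} :
    WordIso v v' ↔ SamePattern v v' := by
  constructor
  · rintro ⟨f, hf, rfl⟩
    refine ⟨by simp, ?_⟩
    rw [← List.map_prod_left_eq_zip]
    simp only [List.mem_map]
    rintro _ ⟨a, ha, rfl⟩ _ ⟨b, hb, rfl⟩
    exact ⟨fun e => congrArg f e, fun e => hf ha hb e⟩
  · intro h
    obtain ⟨f, h1, h2, -⟩ := h.exists_map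
    exact ⟨f, h1, h2⟩

/-- A decidable criterion for the isomorphism of nanowords. -/
def Nanoword.Matches {α β : Type} (w : Nanoword α) (w' : Nanoword β) : Prop :=
  SamePattern w.word w'.word ∧ ∀ p ∈ w.word.zip w'.word, w'.sign p.2 = w.sign p.1

instance {α β : Type} [DecidableEq α] [DecidableEq β] (w : Nanoword α) (w' : Nanoword β) :
    Decidable (w.Matches w') := inferInstanceAs (Decidable (_ ∧ _))

lemma Nanoword.Matches.iso {α β : Type} [Nonempty β] {w : Nanoword α} {w' : Nanoword β}
    (h : w.Matches w') : w.Iso w' := by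
  obtain ⟨f, h1, h2, h3⟩ := h.1.exists_map
  exact ⟨f, h1, h2, fun a ha => h.2 _ (h3 a ha)⟩

lemma Nanoword.Iso.trans {α β δ : Type} {w : Nanoword α} {w' : Nanoword β} {w'' : Nanoword δ}
    (h : w.Iso w') (h' : w'.Iso w'') : w.Iso w'' := by
  obtain ⟨f, f1, f2, f3⟩ := h
  obtain ⟨g, g1, g2, g3⟩ := h'
  have hm : ∀ a ∈ w.word, f a ∈ w'.word := fun a ha => by
    rw [f2]; exact List.mem_map_of_mem ha
  refine ⟨g ∘ f, ?_, ?_, ?_⟩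
  · exact fun a ha b hb e => f1 ha hb (g1 (hm a ha) (hm b hb) e)
  · rw [g2, f2, List.map_map]
  · intro a ha
    rw [Function.comp, g3 _ (hm a ha), f3 a ha]

lemma wordIso_map_iff {α β δ : Type} [Nonempty β] [Nonempty δ] (v : List α) {u : List β}
    {f : β → δ} (hf : Set.InjOn f {a | a ∈ u}) : WordIso v (u.map f) ↔ WordIso v u := by
  rw [wordIso_iff, wordIso_iff]
  unfold SamePattern
  rw [List.length_map, List.zip_map_right]
  refine and_congr_right fun _ => ?_
  simp only [List.mem_map, forall_exists_index, and_imp, forall_apply_eq_imp_iff₂]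
  refine forall₂_congr fun p hp => forall₂_congr fun q hq => iff_congr Iff.rfl ?_
  have h1 : p.2 ∈ u := (List.of_mem_zip (a := p.1) (b := p.2) hp).2
  have h2 : q.2 ∈ u := (List.of_mem_zip (a := q.1) (b := q.2) hq).2
  exact ⟨fun e => hf h1 h2 e, fun e => congrArg f e⟩

/-- Taking images under the renaming matches the sets of letters of the two words, and with them the
sub-words and the products of signs. -/
lemma pairing_congr {α β δ : Type} [Nonempty β] [Nonempty δ] (v : List α) {w : Nanoword β}
    {w' : Nanoword δ} (h : w.Iso w') : pairing v w' = pairing v w := by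
  classical
  obtain ⟨f, hf, hw, hs⟩ := h
  have hfin : w'.word.toFinset = w.word.toFinset.image f := by
    ext; simp [hw]
  have hinj : Set.InjOn f (w.word.toFinset : Set β) := by simpa using hf
  symm
  unfold pairing
  refine Finset.sum_bij (fun S _ => S.image f) ?_ ?_ ?_ ?_
  · intro S hS
    rw [Finset.mem_powerset] at hS ⊢
    convert Finset.image_subset_image (f := f) hS using 1
  · intro S hS T hT e
    rw [Finset.mem_powerset] at hS hT
    have hS' : (S : Set β) ⊆ {a | a ∈ w.word} := fun a ha => by simpa using hS ha
    have hT' : (T : Set β) ⊆ {a | a ∈ w.word} := fun a ha => by simpa using hT ha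
    have : f '' (S : Set β) = f '' (T : Set β) := by
      rw [← Finset.coe_image, ← Finset.coe_image, e]
    exact_mod_cast (hf.image_eq_image_iff hS' hT').1 this
  · intro T hT
    rw [Finset.mem_powerset] at hT
    have hT' : T ⊆ w.word.toFinset.image f := by rw [← hfin]; convert hT
    obtain ⟨S, hS, e⟩ := Finset.subset_image_iff.1 hT'
    exact ⟨S, by rw [Finset.mem_powerset]; convert hS, e⟩
  · intro S hS
    rw [Finset.mem_powerset] at hS
    have hS' : ∀ a ∈ S, a ∈ w.word := fun a ha => by simpa using hS ha
    have e : w'.word.filter (fun a => decide (a ∈ S.image f)) =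
        (w.word.filter (fun a => decide (a ∈ S))).map f := by
      rw [hw, List.filter_map]
      congr 1
      refine List.filter_congr fun a ha => ?_
      simp only [Function.comp, decide_eq_decide, Finset.mem_image]
      exact ⟨fun ⟨b, hb, hab⟩ => hf (hS' b hb) ha hab ▸ hb, fun h => ⟨a, h, rfl⟩⟩
    have hf' : Set.InjOn f {a | a ∈ w.word.filter (fun a => decide (a ∈ S))} :=
      hf.mono fun a ha => (List.mem_filter.1 ha).1
    have hp : ∏ a ∈ S.image f, w'.sign a = ∏ a ∈ S, w.sign a := by
      rw [Finset.prod_image fun a ha b hb => hf (hS' a ha) (hS' b hb)]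
      exact Finset.prod_congr rfl fun a ha => hs a (hS' a ha)
    have hiff : WordIso v (w'.word.filter (fun a => decide (a ∈ S.image f))) ↔
        WordIso v (w.word.filter (fun a => decide (a ∈ S))) := by
      rw [e, wordIso_map_iff v hf']
    rw [hp]
    exact (if_congr hiff rfl rfl).symm

/-- A sum over subsets becomes a sum over sublists, which can be evaluated. -/
lemma sum_powerset_toFinset {β : Type} [DecidableEq β] (φ : Finset β → ℤ) (l : List β)
    (hl : l.Nodup) : ∑ S ∈ l.toFinset.powerset, φ S =
      (l.sublists'.map fun T => φ T.toFinset).sum := by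
  induction l generalizing φ with
  | nil => simp
  | cons a l ih =>
    rw [List.nodup_cons] at hl
    rw [List.toFinset_cons, Finset.sum_powerset_insert (by simpa using hl.1), ih _ hl.2,
      ih (fun S => φ (insert a S)) hl.2, List.sublists'_cons, List.map_append, List.sum_append,
      List.map_map]
    simp only [Function.comp_def, List.toFinset_cons]

/-- The pairing, computed with decidable equality. -/
def pairingDec {α β : Type} [DecidableEq α] [DecidableEq β] (v : List α) (w : Nanoword β) : ℤ :=
  (w.word.dedup.sublists'.map fun S =>
    if SamePattern v (w.word.filter fun a => decide (a ∈ S)) then (S.map w.sign).prod else 0).sum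

lemma pairing_eq_pairingDec {α β : Type} [DecidableEq α] [DecidableEq β] [Nonempty β]
    (v : List α) (w : Nanoword β) : pairing v w = pairingDec v w := by
  have h := sum_powerset_toFinset (fun S =>
    if SamePattern v (w.word.filter fun a => decide (a ∈ S)) then ∏ a ∈ S, w.sign a else 0)
    w.word.dedup (List.nodup_dedup _)
  have e1 : pairing v w = ∑ S ∈ w.word.dedup.toFinset.powerset,
      if SamePattern v (w.word.filter fun a => decide (a ∈ S)) then ∏ a ∈ S, w.sign a else 0 := by
    have ef : w.word.dedup.toFinset = w.word.toFinset := by ext; simp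
    rw [ef, pairing]
    simp only [wordIso_iff]
    congr!
  rw [e1, h, pairingDec]
  congr 1
  refine List.map_congr_left fun T hT => ?_
  have hT' : T.Nodup := (List.mem_sublists'.1 hT).nodup (List.nodup_dedup _)
  rw [List.prod_toFinset _ hT']
  simp only [List.mem_toFinset]

/-- `pairXYXYZZ`, computed with decidable equality. -/
def pairXYXYZZDec {α : Type} [DecidableEq α] (w : Nanoword α) : ℤ :=
  pairingDec [0, 1, 0, 1, 2, 2] w - pairingDec [1, 0, 1, 2, 2, 0] w
    + pairingDec [0, 1, 2, 2, 0, 1] w - pairingDec [1, 2, 2, 0, 1, 0] w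
    + pairingDec [2, 2, 0, 1, 0, 1] w - pairingDec [2, 0, 1, 0, 1, 2] w

/-- `pairXXYYZZ`, computed with decidable equality. -/
def pairXXYYZZDec {α : Type} [DecidableEq α] (w : Nanoword α) : ℤ :=
  pairingDec [0, 0, 1, 1, 2, 2] w - pairingDec [0, 1, 1, 2, 2, 0] w

lemma pairXYXYZZ_eq {β δ : Type} [DecidableEq β] [Nonempty β] [Nonempty δ] {w : Nanoword β}
    {w' : Nanoword δ} (h : w.Iso w') : pairXYXYZZ w' = pairXYXYZZDec w := by
  simp only [pairXYXYZZ, pairXYXYZZDec, pairing_congr _ h, pairing_eq_pairingDec]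

lemma pairXXYYZZ_eq {β δ : Type} [DecidableEq β] [Nonempty β] [Nonempty δ] {w : Nanoword β}
    {w' : Nanoword δ} (h : w.Iso w') : pairXXYYZZ w' = pairXXYYZZDec w := by
  simp only [pairXXYYZZ, pairXXYYZZDec, pairing_congr _ h, pairing_eq_pairingDec]

/-- The base point enters only through the first integer time after it, modulo the length. The
pairings are therefore checked for one period of starting times, without a general invariance
theorem. -/
theorem LatticeLoop.CI3_curve {G : LatticeLoop} {S : List (ℤ × ℤ)} (hS : G.IsCrossingList S)
    {h : ℝ} (hh : 0 < h) {c : ℤ}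
    (hc : ∀ n < G.length, pairXYXYZZDec (G.walkWord S n) = 0 ∧ pairXXYYZZDec (G.walkWord S n) = c)
    {b : ℝ} (hb : (G.curve h hh).IsBasePoint b) (s t : ℝ) :
    CI3 (G.curve h hh) b s t = c * t + (G.curve h hh).index := by
  have hN : (0 : ℤ) < G.length := by exact_mod_cast G.length_pos
  have hi := LatticeLoop.iso_nanoword hS hh hb
  generalize ⌊G.length * b⌋ + 1 = m at hi
  have e : ∃ n : ℕ, n < G.length ∧ G.walkWord S m = G.walkWord S n := by
    refine ⟨(m % G.length).toNat, ?_, ?_⟩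
    · have := Int.emod_lt_of_pos m hN
      have := Int.emod_nonneg m hN.ne'
      omega
    · rw [Int.toNat_of_nonneg (Int.emod_nonneg m hN.ne'),
        ← LatticeLoop.walkWord_add_mul (m % G.length) (m / G.length), mul_comm,
        Int.emod_add_mul_ediv]
  obtain ⟨n, hn, e⟩ := e
  rw [e] at hi
  rw [CI3, pairXYXYZZ_eq hi, pairXXYYZZ_eq hi, (hc n hn).1, (hc n hn).2]
  push_cast
  ring

namespace LatticeLoop

variable (G : LatticeLoop)

/-! ### Tangent lifts of smoothed walks -/

/-- The tangent lift of the smoothed walk with mesh `h`, at time `t`. -/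
noncomputable def liftPoint (h t : ℝ) : ℂ × ℂ :=
  ((h : ℂ) * G.path t, deriv G.path t / ‖deriv G.path t‖)

lemma div_norm_scaled {h c : ℝ} (hh : 0 < h) (hc : 0 < c) (t : ℝ) :
    deriv (fun x : ℝ => (h : ℂ) * G.path (c * x)) t /
      ‖deriv (fun x : ℝ => (h : ℂ) * G.path (c * x)) t‖ =
      deriv G.path (c * t) / ‖deriv G.path (c * t)‖ := by
  have hp := mul_pos hh hc
  rw [deriv_scaled, norm_mul, Complex.norm_real, Real.norm_of_nonneg hp.le,
    Complex.ofReal_mul (h * c), mul_div_mul_left]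
  exact_mod_cast hp.ne'

lemma liftPoint_add_mul (h t : ℝ) (n : ℤ) :
    G.liftPoint h (t + n * G.length) = G.liftPoint h t := by
  have e := deriv_comp_add_const G.path (n * G.length : ℝ) t
  have e2 : (fun x => G.path (x + n * G.length)) = G.path :=
    funext fun x => G.path_add_mul x n
  rw [e2] at e
  rw [liftPoint, liftPoint, path_add_mul, ← e]

/-- Every time can be moved by periods into `(0, length]`, which is then cut at `a`. The cut will
separate the part inside the box from the rest. -/
lemma tangentLift_curve {h : ℝ} (hh : 0 < h) (a : ℝ) :
    tangentLift (G.curve h hh) =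
      G.liftPoint h '' Set.Ioo 0 a ∪ G.liftPoint h '' Set.Icc a G.length := by
  have hN := G.length_pos'
  have e : ∀ t, ((G.curve h hh).γ 0 t, deriv ((G.curve h hh).γ 0) t /
      (‖deriv ((G.curve h hh).γ 0) t‖ : ℂ)) = G.liftPoint h (G.length * t) := by
    intro t
    exact Prod.ext rfl (G.div_norm_scaled hh hN t)
  ext p
  constructor
  · rintro ⟨i, t, rfl⟩
    obtain rfl : i = 0 := Subsingleton.elim _ _
    rw [e]
    obtain ⟨n, ⟨h1, h2⟩, -⟩ := existsUnique_add_zsmul_mem_Ioc hN (G.length * t) 0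
    rw [zsmul_eq_mul] at h1 h2
    rw [← G.liftPoint_add_mul h _ n]
    rw [zero_add] at h2
    rcases lt_or_ge (G.length * t + n * G.length) a with h3 | h3
    · exact Or.inl ⟨_, ⟨h1, h3⟩, rfl⟩
    · exact Or.inr ⟨_, ⟨h3, h2⟩, rfl⟩
  · have : ∀ s, G.liftPoint h s ∈ tangentLift (G.curve h hh) := by
      intro s
      refine ⟨0, s / G.length, ?_⟩
      rw [e, mul_div_cancel₀ _ hN.ne']
    rintro (⟨s, -, rfl⟩ | ⟨s, -, rfl⟩) <;> exact this s

lemma deriv_path_straight {k : ℤ} (hs : G.step (k - 1) = G.step k) {t : ℝ} (ht : |t - k| < 3 / 4) :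
    deriv G.path t = toC (G.step k) := by
  rw [G.deriv_path ht, hs]; push_cast; ring

lemma arcLift_scaled {h c : ℝ} (hh : 0 < h) (hc : 0 < c) :
    arcLift (fun x : ℝ => (h : ℂ) * G.path (c * x)) 0 1 = G.liftPoint h '' Set.Ioo 0 c := by
  ext p
  constructor
  · rintro ⟨t, ⟨h1, h2⟩, rfl⟩
    refine ⟨c * t, ⟨mul_pos hc h1, by nlinarith⟩, ?_⟩
    exact Prod.ext rfl (G.div_norm_scaled hh hc t).symm
  · rintro ⟨t, ⟨h1, h2⟩, rfl⟩
    refine ⟨t / c, ⟨div_pos h1 hc, by rwa [div_lt_one hc]⟩, ?_⟩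
    refine Prod.ext ?_ ?_
    · simp only [liftPoint, mul_div_cancel₀ _ hc.ne']
    · rw [G.div_norm_scaled hh hc, mul_div_cancel₀ _ hc.ne']; rfl

/-! ### Insertion of a pair of opposite kinks into a walk -/

/-- `G'` arises from `G` by replacing the horizontal strand between the times `0` and `2 * M` by a
path of length `L` inside the square of half-width `M` whose only double points are those at the
times `a₁, a₂` and `b₁, b₂`, with opposite signs. -/
structure KinkInsertion (G G' : LatticeLoop) (M L a₁ a₂ b₁ b₂ : ℕ) : Prop where
  pos : 0 < M
  length_lt : 2 * M < G.length
  length_add : G'.length + 2 * M = G.length + L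
  -- The index `n - 1` runs one vertex beyond each end of the strand, and `common` also overlaps
  -- both ends. This determines both steps at the interface vertices, so the roundings there agree.
  strand : ∀ n < 2 * M + 3, G.vertex ((n : ℤ) - 1) = ((n : ℤ) - 1 - M, 0)
  common : ∀ n < G.length - 2 * M + 3,
    G'.vertex ((L : ℤ) - 1 + n) = G.vertex (2 * (M : ℤ) - 1 + n)
  inside : ∀ n < L, 0 < n → |(G'.vertex n).1| < M ∧ |(G'.vertex n).2| < M
  outside : ∀ n < G.length, 2 * M < n → M < |(G.vertex n).1| ∨ M < |(G.vertex n).2|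
  -- Time `0` is left out because it lies on the boundary of the box.
  double : ∀ n < L, ∀ m < n, m = 0 ∨
    (G'.vertex m = G'.vertex n ↔ m = a₁ ∧ n = a₂ ∨ m = b₁ ∧ n = b₂)
  order : 0 < a₁ ∧ a₁ < a₂ ∧ a₂ < b₁ ∧ b₁ < b₂ ∧ b₂ < L
  sign : det (G'.step a₂) (G'.step a₁) * det (G'.step b₂) (G'.step b₁) < 0

namespace KinkInsertion

variable {G} {G' : LatticeLoop} {M L a₁ a₂ b₁ b₂ : ℕ} (H : KinkInsertion G G' M L a₁ a₂ b₁ b₂)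
include H

lemma vertex_strand {k : ℤ} (h1 : -1 ≤ k) (h2 : k ≤ 2 * M + 1) : G.vertex k = (k - M, 0) := by
  have := H.strand (k + 1).toNat (by omega)
  rwa [Int.toNat_of_nonneg (by omega), add_sub_cancel_right] at this

lemma vertex_common {k : ℤ} (h1 : L - 1 ≤ k) (h2 : k ≤ G'.length + 1) :
    G'.vertex k = G.vertex (k - L + 2 * M) := by
  have hl := H.length_add
  have hl2 := H.length_lt
  have := H.common (k - L + 1).toNat (by omega)
  rw [Int.toNat_of_nonneg (by omega)] at this
  rw [show (L : ℤ) - 1 + (k - L + 1) = k by ring] at this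
  rw [this]
  congr 1
  ring

lemma step_strand {k : ℤ} (h1 : -1 ≤ k) (h2 : k ≤ 2 * M) : G.step k = (1, 0) := by
  rw [step, H.vertex_strand h1 (by omega), H.vertex_strand (by omega) (by omega)]
  ext <;> simp

lemma step_common {k : ℤ} (h1 : L - 1 ≤ k) (h2 : k ≤ G'.length) :
    G'.step k = G.step (k - L + 2 * M) := by
  rw [step, step, H.vertex_common (by omega) (by omega), H.vertex_common h1 (by omega)]
  congr 2
  ring

lemma length_eq : (G'.length : ℤ) = G.length + L - 2 * M := by
  have := H.length_add
  omega

lemma vertex_start {k : ℤ} (h1 : -1 ≤ k) (h2 : k ≤ 1) : G'.vertex k = (k - M, 0) := by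
  have hl := H.length_eq
  have hl2 := H.length_lt
  have hp := H.pos
  have e := G'.vertex_add_mul k 1
  have e' := G.vertex_add_mul k 1
  rw [one_mul] at e e'
  rw [← e, H.vertex_common (by omega) (by omega),
    show k + (G'.length : ℤ) - L + 2 * M = k + G.length by rw [hl]; ring, e',
    H.vertex_strand h1 (by omega)]

lemma step_start {k : ℤ} (h1 : -1 ≤ k) (h2 : k ≤ 0) : G'.step k = (1, 0) := by
  rw [step, H.vertex_start h1 (by omega), H.vertex_start (by omega) (by omega)]
  ext <;> simp

lemma path_strand {t : ℝ} (h1 : -(1 / 2) < t) (h2 : t < 2 * M + 1 / 2) :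
    G.path t = ((t - M : ℝ) : ℂ) ∧ deriv G.path t = 1 := by
  have hr := abs_sub_round t
  have h34 : |t - (round t : ℤ)| < 3 / 4 := lt_of_le_of_lt hr (by norm_num)
  rw [abs_le] at hr
  rw [G.path_eq_piece h34]
  generalize round t = k at *
  have k1 : (-1 : ℝ) < k := by linarith
  have k2 : (k : ℝ) < 2 * M + 1 := by linarith
  have k1' : -1 < k := by exact_mod_cast k1
  have k2' : k < 2 * M + 1 := by exact_mod_cast k2
  have e1 : G.step (k - 1) = (1, 0) := H.step_strand (by omega) (by omega)
  have e2 : G.step k = (1, 0) := H.step_strand (by omega) (by omega)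
  constructor
  · rw [G.piece_straight (e1.trans e2.symm), e2, H.vertex_strand (by omega) (by omega)]
    apply Complex.ext <;> simp
  · rw [G.deriv_path_straight (e1.trans e2.symm) h34, e2]
    apply Complex.ext <;> simp

/-- A piece depends only on its vertex and the two adjacent steps, and these agree after a shift by
`L - 2 * M`. -/
lemma liftPoint_common (h : ℝ) {t : ℝ} (h1 : L ≤ t) (h2 : t ≤ G'.length) :
    G'.liftPoint h t = G.liftPoint h (t - L + 2 * M) := by
  have hr := abs_sub_round t
  have h34 : |t - (round t : ℤ)| < 3 / 4 := lt_of_le_of_lt hr (by norm_num)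
  rw [abs_le] at hr
  generalize round t = k at *
  have k1 : (L : ℝ) < k + 1 := by linarith
  have k2 : (k : ℝ) < G'.length + 1 := by linarith
  have k1' : L < k + 1 := by exact_mod_cast k1
  have k2' : k < G'.length + 1 := by exact_mod_cast k2
  have hu : t - L + 2 * M - ((k - L + 2 * M : ℤ) : ℝ) = t - k := by push_cast; ring
  have e1 : G'.step (k - 1) = G.step (k - L + 2 * M - 1) := by
    rw [H.step_common (by omega) (by omega)]; congr 1; ring
  rw [liftPoint, liftPoint, G'.path_eq_piece h34, G'.deriv_path h34,
    G.path_eq_piece (k := k - L + 2 * M) (by rwa [hu]),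
    G.deriv_path (k := k - L + 2 * M) (by rwa [hu]), piece, piece, hu, e1,
    H.step_common (by omega) (by omega), H.vertex_common (by omega) (by omega)]

/-- Away from the ends the vertex is at integer distance at least `M + 1` in some coordinate, and
rounding costs at most `1 / 2`. Near the two ends the walk continues the strand horizontally out of
the square. -/
lemma path_outside {t : ℝ} (h1 : 2 * M ≤ t) (h2 : t ≤ G.length) :
    M ≤ |(G.path t).re| ∨ M ≤ |(G.path t).im| := by
  have hr := abs_sub_round t
  have h34 : |t - (round t : ℤ)| < 3 / 4 := lt_of_le_of_lt hr (by norm_num)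
  have hM : (1 : ℝ) ≤ M := by exact_mod_cast H.pos
  have hk : G.path t = G.piece (round t) t := rfl
  have hr' := abs_le.1 hr
  generalize round t = k at *
  have k1 : (2 * M : ℝ) < k + 1 := by linarith
  have k2 : (k : ℝ) < G.length + 1 := by linarith
  have k1' : 2 * M < k + 1 := by exact_mod_cast k1
  have k2' : k < G.length + 1 := by exact_mod_cast k2
  rcases eq_or_lt_of_le (Int.lt_add_one_iff.1 k1') with e | e
  · left
    have e' : (k : ℝ) = 2 * M := by rw [← e]; push_cast; ring
    rcases eq_or_lt_of_le hr with e3 | e3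
    · rw [hk, ← e, G.piece_straight (by
        rw [H.step_strand (by omega) (by omega), H.step_strand (by omega) (by omega)]),
        H.step_strand (by omega) (by omega), H.vertex_strand (by omega) (by omega)]
      have : (M : ℝ) ≤ 2 * M - M + (t - 2 * M) := by linarith
      simpa using this.trans (le_abs_self _)
    · rw [(H.path_strand (by linarith) (by linarith [(abs_lt.1 e3).2])).1, Complex.ofReal_re]
      exact le_trans (by linarith) (le_abs_self _)
  · rcases eq_or_lt_of_le (Int.lt_add_one_iff.1 k2') with e2 | e2
    · left
      have e' : (k : ℝ) = G.length := by rw [e2]; push_cast; ring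
      have h0 : G.step 0 = (1, 0) := H.step_strand (by omega) (by omega)
      have h0' : G.step (-1) = (1, 0) := H.step_strand (by omega) (by omega)
      have s0 := G.step_add_mul 0 1
      have s1 := G.step_add_mul (-1) 1
      have v0 := G.vertex_add_mul 0 1
      rw [one_mul, zero_add, ← e2] at s0 v0
      rw [one_mul, neg_add_eq_sub, ← e2] at s1
      rw [hk, G.piece_straight (by rw [s0, s1, h0, h0']), s0, h0, v0,
        H.vertex_strand (by omega) (by omega)]
      have : (M : ℝ) ≤ -(-M + (t - k)) := by linarith
      simpa using this.trans (neg_le_abs _)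
    · have hcell := G.piece_mem_cell k t
      rw [← hk] at hcell
      have := H.outside k.toNat (by omega) (by omega)
      rw [Int.toNat_of_nonneg (by omega)] at this
      rcases this with h | h
      · left
        have h' : (M : ℝ) + 1 ≤ |((G.vertex k).1 : ℝ)| := by exact_mod_cast h
        have := abs_sub_abs_le_abs_sub ((G.vertex k).1 : ℝ) (G.path t).re
        rw [abs_sub_comm] at this
        have := abs_nonneg ((G.path t).im - (G.vertex k).2)
        linarith
      · right
        have h' : (M : ℝ) + 1 ≤ |((G.vertex k).2 : ℝ)| := by exact_mod_cast h
        have := abs_sub_abs_le_abs_sub ((G.vertex k).2 : ℝ) (G.path t).im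
        rw [abs_sub_comm] at this
        have := abs_nonneg ((G.path t).re - (G.vertex k).1)
        linarith

lemma path_inside {t : ℝ} (h1 : 0 < t) (h2 : t < L) :
    |(G'.path t).re| < M ∧ |(G'.path t).im| < M := by
  have hr := abs_sub_round t
  have hM : (1 : ℝ) ≤ M := by exact_mod_cast H.pos
  have hk : G'.path t = G'.piece (round t) t := rfl
  have hr' := abs_le.1 hr
  have hp := H.pos
  have hl := H.length_eq
  have hl2 := H.length_lt
  generalize round t = k at *
  have k1 : (-1 : ℝ) < k := by linarith
  have k2 : (k : ℝ) < L + 1 := by linarith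
  have k1' : -1 < k := by exact_mod_cast k1
  have k2' : k < L + 1 := by exact_mod_cast k2
  have hk3 : k = 0 ∨ k = L ∨ (0 < k ∧ k < L) := by omega
  rcases hk3 with e | e | ⟨e1, e2⟩
  · subst e
    rw [hk, G'.piece_straight (by
        rw [H.step_start (by omega) (by omega), H.step_start (by omega) (by omega)]),
        H.step_start (by omega) (by omega), H.vertex_start (by omega) (by omega)]
    rw [Int.cast_zero] at hr'
    simp only [zero_sub, Int.cast_zero, sub_zero, Complex.add_re, toC_re, Int.cast_neg,
      Int.cast_natCast, Complex.mul_re, Complex.ofReal_re, Int.cast_one, mul_one, Complex.ofReal_im,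
      toC_im, mul_zero, Complex.add_im, Complex.mul_im, add_zero, abs_zero]
    refine ⟨?_, by linarith⟩
    rw [abs_lt]; constructor <;> linarith
  · subst e
    have s1 : G'.step ((L : ℤ) - 1) = (1, 0) := by
      rw [H.step_common (by omega) (by omega), H.step_strand (by omega) (by omega)]
    have s2 : G'.step (L : ℤ) = (1, 0) := by
      rw [H.step_common (by omega) (by omega), H.step_strand (by omega) (by omega)]
    rw [hk, G'.piece_straight (s1.trans s2.symm), s2, H.vertex_common (by omega) (by omega),
      H.vertex_strand (by omega) (by omega)]
    rw [Int.cast_natCast] at hr'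
    simp only [sub_self, zero_add, Int.cast_natCast, Complex.add_re, toC_re, Int.cast_sub,
      Int.cast_mul, Int.cast_ofNat, Complex.mul_re, Complex.ofReal_re, Int.cast_one, mul_one,
      Complex.ofReal_im, toC_im, Int.cast_zero, mul_zero, sub_zero, Complex.add_im, Complex.mul_im,
      add_zero, abs_zero]
    refine ⟨?_, by linarith⟩
    rw [abs_lt]; constructor <;> linarith
  · have hcell := G'.piece_mem_cell k t
    rw [← hk] at hcell
    have := H.inside k.toNat (by omega) (by omega)
    rw [Int.toNat_of_nonneg (by omega)] at this
    have g1 : |((G'.vertex k).1 : ℝ)| + 1 ≤ M := by exact_mod_cast this.1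
    have g2 : |((G'.vertex k).2 : ℝ)| + 1 ≤ M := by exact_mod_cast this.2
    have := abs_sub_abs_le_abs_sub (G'.path t).re ((G'.vertex k).1 : ℝ)
    have := abs_sub_abs_le_abs_sub (G'.path t).im ((G'.vertex k).2 : ℝ)
    have := abs_nonneg ((G'.path t).im - (G'.vertex k).2)
    have := abs_nonneg ((G'.path t).re - (G'.vertex k).1)
    constructor <;> linarith

end KinkInsertion
-- Rescaling by `1 / M` and the kink relation for curves.
namespace KinkInsertion

variable {G G' : LatticeLoop} {M L a₁ a₂ b₁ b₂ : ℕ} (H : KinkInsertion G G' M L a₁ a₂ b₁ b₂)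

/-- The mesh `1 / M` turns the square of half-width `M` into the unit box of the skein relations. -/
lemma scaled_mem_box {M : ℕ} (hM : 0 < M) (z : ℂ) :
    (((M : ℝ)⁻¹ : ℝ) : ℂ) * z ∈ box ↔ |z.re| < M ∧ |z.im| < M := by
  have hM' : (0 : ℝ) < M := by exact_mod_cast hM
  have key : ∀ x : ℝ, |(M : ℝ)⁻¹ * x| < 1 ↔ |x| < M := by
    intro x
    rw [abs_mul, abs_of_pos (inv_pos.2 hM'), inv_mul_lt_one₀ hM']
  rw [box, Set.mem_ofPred_eq, Complex.re_ofReal_mul, Complex.im_ofReal_mul, key, key]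

lemma graphArc_zero_deriv (x : ℝ) : deriv (graphArc fun _ => 0) x = 1 := by
  have : (graphArc fun _ => 0) = fun x : ℝ => (x : ℂ) := by
    funext x; apply Complex.ext <;> simp [graphArc]
  rw [this]
  exact Complex.ofRealCLM.hasDerivAt.deriv

lemma split_lift {T A B : Set (ℂ × ℂ)} (hT : T = A ∪ B) (hA : ∀ p ∈ A, p.1 ∈ box)
    (hB : ∀ p ∈ B, p.1 ∉ box) : {p ∈ T | p.1 ∈ box} = A ∧ {p ∈ T | p.1 ∉ box} = B := by
  subst hT
  constructor
  · ext p
    exact ⟨fun ⟨h, hb⟩ => h.resolve_right fun h' => hB p h' hb, fun h => ⟨Or.inl h, hA p h⟩⟩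
  · ext p
    exact ⟨fun ⟨h, hb⟩ => h.resolve_left fun h' => hb (hA p h'), fun h => ⟨Or.inr h, hB p h⟩⟩

include H

lemma mesh_pos : (0 : ℝ) < (M : ℝ)⁻¹ := inv_pos.2 (by exact_mod_cast H.pos)

lemma split_base : liftInBox (G.curve (M : ℝ)⁻¹ H.mesh_pos) =
      G.liftPoint (M : ℝ)⁻¹ '' Set.Ioo 0 (2 * M) ∧
    liftOutsideBox (G.curve (M : ℝ)⁻¹ H.mesh_pos) =
      G.liftPoint (M : ℝ)⁻¹ '' Set.Icc (2 * M) G.length := by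
  refine split_lift (G.tangentLift_curve H.mesh_pos (2 * M)) ?_ ?_
  · rintro _ ⟨t, ⟨h1, h2⟩, rfl⟩
    have := (H.path_strand (t := t) (by linarith) (by linarith)).1
    simp only [liftPoint, scaled_mem_box H.pos, this, Complex.ofReal_re, Complex.ofReal_im, abs_zero]
    exact ⟨by rw [abs_lt]; constructor <;> linarith, by exact_mod_cast H.pos⟩
  · rintro _ ⟨t, ⟨h1, h2⟩, rfl⟩
    simp only [liftPoint, scaled_mem_box H.pos]
    rintro ⟨h3, h4⟩
    rcases H.path_outside h1 h2 with h | h <;> linarith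

lemma liftPoint_image_common (h : ℝ) : G'.liftPoint h '' Set.Icc (L : ℝ) G'.length =
    G.liftPoint h '' Set.Icc (2 * M : ℝ) G.length := by
  have hl : (G'.length : ℝ) = G.length + L - 2 * M := by exact_mod_cast H.length_eq
  ext p
  constructor
  · rintro ⟨t, ⟨h1, h2⟩, rfl⟩
    exact ⟨t - L + 2 * M, ⟨by linarith, by linarith⟩, (H.liftPoint_common h h1 h2).symm⟩
  · rintro ⟨t, ⟨h1, h2⟩, rfl⟩
    refine ⟨t - 2 * M + L, ⟨by linarith, by linarith⟩, ?_⟩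
    rw [H.liftPoint_common h (by linarith) (by linarith)]
    congr 1
    ring

lemma split_kinked : liftInBox (G'.curve (M : ℝ)⁻¹ H.mesh_pos) =
      G'.liftPoint (M : ℝ)⁻¹ '' Set.Ioo 0 L ∧
    liftOutsideBox (G'.curve (M : ℝ)⁻¹ H.mesh_pos) =
      G.liftPoint (M : ℝ)⁻¹ '' Set.Icc (2 * M) G.length := by
  rw [← H.liftPoint_image_common]
  refine split_lift (G'.tangentLift_curve H.mesh_pos L) ?_ ?_
  · rintro _ ⟨t, ⟨h1, h2⟩, rfl⟩
    simp only [liftPoint, scaled_mem_box H.pos]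
    exact H.path_inside h1 h2
  · rintro _ hp hb
    rw [H.liftPoint_image_common] at hp
    have := H.split_base.2
    rw [← this] at hp
    exact hp.2 hb

lemma arcLift_strand : arcLift (graphArc fun _ => 0) (-1) 1 =
    G.liftPoint (M : ℝ)⁻¹ '' Set.Ioo 0 (2 * M) := by
  have hM : (0 : ℝ) < M := by exact_mod_cast H.pos
  have key : ∀ t ∈ Set.Ioo (0 : ℝ) (2 * M), G.liftPoint (M : ℝ)⁻¹ t =
      (graphArc (fun _ => 0) ((M : ℝ)⁻¹ * (t - M)),
        deriv (graphArc fun _ => 0) ((M : ℝ)⁻¹ * (t - M)) /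
          ‖deriv (graphArc fun _ => 0) ((M : ℝ)⁻¹ * (t - M))‖) := by
    rintro t ⟨h1, h2⟩
    have := H.path_strand (t := t) (by linarith) (by linarith)
    rw [liftPoint, this.1, this.2, graphArc_zero_deriv]
    refine Prod.ext ?_ rfl
    apply Complex.ext <;> simp [graphArc]
  ext p
  constructor
  · rintro ⟨x, ⟨h1, h2⟩, rfl⟩
    refine ⟨M * x + M, ⟨by nlinarith, by nlinarith⟩, ?_⟩
    rw [key _ ⟨by nlinarith, by nlinarith⟩]
    have : (M : ℝ)⁻¹ * (M * x + M - M) = x := by field_simp; ring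
    rw [this]
  · rintro ⟨t, ht, rfl⟩
    refine ⟨(M : ℝ)⁻¹ * (t - M), ?_, key t ht⟩
    have e1 : (M : ℝ)⁻¹ * (t - M) = t / M - 1 := by field_simp
    rw [e1]
    have h1 : 0 < t / M := div_pos ht.1 hM
    have h2 : t / M < 2 := by rw [div_lt_iff₀ hM]; exact ht.2
    constructor <;> linarith

lemma length_arc_pos : (0 : ℝ) < L := by
  have h := H.order
  exact_mod_cast (by omega : 0 < L)

lemma length_arc_le : (L : ℝ) ≤ G'.length := by
  have h := H.length_eq
  have h2 := H.length_lt
  exact_mod_cast (by omega : L ≤ G'.length)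

lemma vertex_double {m n : ℕ} (h : m = a₁ ∧ n = a₂ ∨ m = b₁ ∧ n = b₂) :
    G'.vertex m = G'.vertex n := by
  have ho := H.order
  exact ((H.double n (by omega) m (by omega)).resolve_left (by omega)).2 h

lemma scaled_path_eq_iff {s t : ℝ} (hs : 0 < s) (hst : s < t) (ht : t < 1) :
    (((M : ℝ)⁻¹ : ℝ) : ℂ) * G'.path (L * s) = (((M : ℝ)⁻¹ : ℝ) : ℂ) * G'.path (L * t) ↔
      (s = (a₁ : ℝ) / L ∧ t = (a₂ : ℝ) / L) ∨ (s = (b₁ : ℝ) / L ∧ t = (b₂ : ℝ) / L) := by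
  have hL := H.length_arc_pos
  have hLe := H.length_arc_le
  have hc : (((M : ℝ)⁻¹ : ℝ) : ℂ) ≠ 0 := by exact_mod_cast H.mesh_pos.ne'
  constructor
  · intro e
    rcases G'.path_eq (mul_left_cancel₀ hc e) with ⟨n, hn⟩ | ⟨k, l, hk, hl, hv, -⟩
    -- Times in `(0, L)` differ by less than one period, as `L` is at most the length of the kinked
    -- walk.
    · exfalso
      have h1 : 0 < (n : ℝ) * G'.length := by nlinarith
      have h2 : (n : ℝ) * G'.length < 1 * G'.length := by nlinarith
      have h3 : (0 : ℝ) < n := pos_of_mul_pos_left h1 G'.length_pos'.le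
      have h4 : (n : ℝ) < 1 := lt_of_mul_lt_mul_right h2 G'.length_pos'.le
      have h3' : 0 < n := by exact_mod_cast h3
      have h4' : n < 1 := by exact_mod_cast h4
      omega
    · have k0 : (0 : ℝ) < k := by rw [← hk]; positivity
      have kl : (k : ℝ) < l := by rw [← hk, ← hl]; exact mul_lt_mul_of_pos_left hst hL
      have lL : (l : ℝ) < L := by rw [← hl]; nlinarith
      have k0' : 0 < k := by exact_mod_cast k0
      have kl' : k < l := by exact_mod_cast kl
      have lL' : l < L := by exact_mod_cast lL
      lift k to ℕ using k0'.le
      lift l to ℕ using by omega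
      have := ((H.double l (by omega) k (by omega)).resolve_left (by omega)).1 hv
      rw [eq_div_iff hL.ne', eq_div_iff hL.ne', eq_div_iff hL.ne', eq_div_iff hL.ne',
        mul_comm s, mul_comm t, hk, hl]
      exact_mod_cast this
  · intro h
    have : ∃ m n : ℕ, (m = a₁ ∧ n = a₂ ∨ m = b₁ ∧ n = b₂) ∧ s = (m : ℝ) / L ∧ t = (n : ℝ) / L := by
      rcases h with h | h
      · exact ⟨a₁, a₂, Or.inl ⟨rfl, rfl⟩, h⟩
      · exact ⟨b₁, b₂, Or.inr ⟨rfl, rfl⟩, h⟩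
    obtain ⟨m, n, hmn, rfl, rfl⟩ := this
    have e1 := G'.path_intCast m
    have e2 := G'.path_intCast n
    rw [Int.cast_natCast] at e1 e2
    rw [mul_div_cancel₀ _ hL.ne', mul_div_cancel₀ _ hL.ne', e1, e2, H.vertex_double hmn]

lemma deriv_double {m n : ℕ} (h : m = a₁ ∧ n = a₂ ∨ m = b₁ ∧ n = b₂)
    (hd : det (G'.step n) (G'.step m) ≠ 0) :
    deriv G'.path m = toC (G'.step m) ∧ deriv G'.path n = toC (G'.step n) := by
  have := G'.deriv_path_intCast (H.vertex_double h) (by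
    simp only [det] at hd ⊢; intro h0; apply hd; linarith)
  rwa [Int.cast_natCast, Int.cast_natCast] at this

theorem kinkPair : KinkPair (G.curve (M : ℝ)⁻¹ H.mesh_pos) (G'.curve (M : ℝ)⁻¹ H.mesh_pos) := by
  have hL := H.length_arc_pos
  have hM : (0 : ℝ) < M := by exact_mod_cast H.pos
  have hsign := H.sign
  obtain ⟨o1, o2, o3, o4, o5⟩ := H.order
  -- The strand is the graph of `0`; the kinked arc is the time interval `[0, L]` rescaled to `[0,
  -- 1]`.
  refine ⟨by rw [H.split_base.2, H.split_kinked.2], fun _ => 0,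
    fun x : ℝ => (((M : ℝ)⁻¹ : ℝ) : ℂ) * G'.path (L * x),
    (a₁ : ℝ) / L, (a₂ : ℝ) / L, (b₁ : ℝ) / L, (b₂ : ℝ) / L,
    ⟨contDiff_const, by simp⟩, ?_, ?_, ?_, ?_, ?_, ?_, ?_, ?_, ?_, ?_, ?_, ?_, ?_, ?_⟩
  · rw [H.split_base.1, H.arcLift_strand]
  · exact contDiff_const.mul (G'.contDiff_path.comp (by fun_prop))
  · intro t _
    rw [deriv_scaled]
    refine mul_ne_zero ?_ (G'.deriv_path_ne_zero _)
    exact_mod_cast (mul_pos H.mesh_pos hL).ne'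
  · have e := G'.path_intCast 0
    rw [Int.cast_zero] at e
    beta_reduce
    rw [mul_zero, e, H.vertex_start (by norm_num) (by norm_num)]
    apply Complex.ext <;> simp [graphArc, hM.ne']
  · have e := G'.path_intCast L
    have hl := H.length_eq
    have hl2 := H.length_lt
    rw [Int.cast_natCast] at e
    beta_reduce
    rw [mul_one, e, H.vertex_common (by omega) (by omega), H.vertex_strand (by omega) (by omega)]
    apply Complex.ext <;> simp [graphArc]
    field_simp
    ring
  · rintro t ⟨h1, h2⟩
    rw [scaled_mem_box H.pos]
    exact H.path_inside (mul_pos hL h1) (by nlinarith)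
  · rw [H.split_kinked.1, arcLift_scaled G' H.mesh_pos hL]
  · exact div_pos (by exact_mod_cast o1) hL
  · exact div_lt_div_of_pos_right (by exact_mod_cast o2) hL
  · exact div_lt_div_of_pos_right (by exact_mod_cast o3) hL
  · exact div_lt_div_of_pos_right (by exact_mod_cast o4) hL
  · rw [div_lt_one hL]; exact_mod_cast o5
  · intro s t hs hst ht
    exact H.scaled_path_eq_iff hs hst ht
  · have da := H.deriv_double (m := a₁) (n := a₂) (Or.inl ⟨rfl, rfl⟩) (left_ne_zero_of_mul hsign.ne)
    have db := H.deriv_double (m := b₁) (n := b₂) (Or.inr ⟨rfl, rfl⟩) (right_ne_zero_of_mul hsign.ne)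
    simp only [deriv_scaled, mul_div_cancel₀ _ hL.ne', da.1, da.2, db.1, db.2, cross_mul_left,
      cross_toC]
    have hp := mul_pos H.mesh_pos hL
    have hs' : ((det (G'.step a₂) (G'.step a₁) : ℝ) * det (G'.step b₂) (G'.step b₁)) < 0 := by
      exact_mod_cast hsign
    have hq := mul_pos (mul_pos hp hp) (mul_pos hp hp)
    have := mul_neg_of_pos_of_neg hq hs'
    calc _ = _ := by ring
      _ < 0 := this

end KinkInsertion

/-! ### HOMFLY polynomials of walks -/

/-- A curve is its own split union with the empty collection. Compactness supplies a vertical line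
to its right. -/
lemma hasHomfly_standard {k : ℤ} (hk : k ≠ 0) (G : LatticeLoop) {h : ℝ} (hh : 0 < h)
    (hs : IsStandard k (G.curve h hh)) : HasHomfly (G.curve h hh) (homflyZ k hk) := by
  have hsplit : IsSplitUnion (G.curve h hh) emptyCurves (G.curve h hh) := by
    have he : tangentLift emptyCurves = ∅ := by
      ext p
      simp only [Set.mem_empty_iff_false, iff_false]
      rintro ⟨i, -⟩
      exact i.elim0
    refine ⟨by rw [he, Set.union_empty], ?_⟩
    have hc : IsCompact ((fun t => (h * (G.path t).re : ℝ)) '' Set.Icc 0 G.length) :=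
      isCompact_Icc.image (continuous_const.mul
        (Complex.continuous_re.comp G.contDiff_path.continuous))
    obtain ⟨c, hc⟩ := hc.bddAbove
    refine ⟨c + 1, ?_, by rw [he]; simp⟩
    rw [G.tangentLift_curve hh 0]
    rintro p (⟨t, ⟨h1, h2⟩, rfl⟩ | ⟨t, ht, rfl⟩)
    · linarith
    · have : h * (G.path t).re ≤ c := hc ⟨t, ht, rfl⟩
      simp only [liftPoint, Complex.re_ofReal_mul]
      linarith
  have hr := SkeinRelation.splitUnion k _ _ _ hs hsplit
  rw [standardValue, dif_neg hk] at hr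
  exact Submodule.subset_span hr

lemma hasHomfly_kinkPair {m n : ℕ} {Γ : PlaneCurves m} {Γ' : PlaneCurves n} (hk : KinkPair Γ Γ')
    {P : HomflyRing} (hP : HasHomfly Γ P) : HasHomfly Γ' (homflyX ^ 2 * P) := by
  have h1 : cls Γ' - homflyX ^ 2 • cls Γ ∈ Submodule.span HomflyRing {r | SkeinRelation r} :=
    Submodule.subset_span (SkeinRelation.kinks Γ Γ' hk)
  have h2 := Submodule.add_mem _ h1 (Submodule.smul_mem _ (homflyX ^ 2) hP)
  rw [smul_sub, smul_smul] at h2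
  rw [HasHomfly]
  convert h2 using 1
  abel

end LatticeLoop

/-! ### Lattice walks given by lists -/

/-- The vertices passed by the list of steps `l` from the point `v`, without the last one. -/
def verticesFrom : ℤ × ℤ → List (ℤ × ℤ) → List (ℤ × ℤ)
  | _, [] => []
  | v, d :: l => v :: verticesFrom (v + d) l

/-- The periodic extension of a list of vertices. -/
def cyclicVertex (vs : List (ℤ × ℤ)) (k : ℤ) : ℤ × ℤ := vs.getD (k % vs.length).toNat 0

/-- The conditions on a lattice loop that concern the `n`-th and the preceding vertices. -/
def LoopAt (p : ℤ → ℤ × ℤ) (n : ℕ) : Prop :=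
  dot (p (n + 1) - p n) (p (n + 1) - p n) = 1 ∧
    0 ≤ dot (p n - p (n - 1)) (p (n + 1) - p n) ∧
    ∀ m < n, p m = p n → p m - p (m - 1) = p (m + 1) - p m ∧ p n - p (n - 1) = p (n + 1) - p n ∧
      det (p (m + 1) - p m) (p (n + 1) - p n) ≠ 0

instance (p : ℤ → ℤ × ℤ) (n : ℕ) : Decidable (LoopAt p n) :=
  inferInstanceAs (Decidable (_ ∧ _ ∧ ∀ _ < _, _))

/-- The periodic extension of `vs` is a lattice loop. -/
def IsLoop (vs : List (ℤ × ℤ)) : Prop :=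
  0 < vs.length ∧ ∀ n < vs.length, LoopAt (cyclicVertex vs) n

instance (vs : List (ℤ × ℤ)) : Decidable (IsLoop vs) :=
  inferInstanceAs (Decidable (_ ∧ ∀ _ < _, _))

lemma cyclicVertex_congr {vs : List (ℤ × ℤ)} {j k : ℤ} (h : j % vs.length = k % vs.length) :
    cyclicVertex vs j = cyclicVertex vs k := by
  rw [cyclicVertex, cyclicVertex, h]

lemma exists_residue {N : ℕ} (hN : 0 < N) (k : ℤ) : ∃ n : ℕ, n < N ∧ k % N = n := by
  have hN' : (0 : ℤ) < N := by exact_mod_cast hN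
  have := Int.emod_lt_of_pos k hN'
  have := Int.emod_nonneg k hN'.ne'
  exact ⟨(k % N).toNat, by omega, by omega⟩

lemma cyclicVertex_residue {vs : List (ℤ × ℤ)} {k : ℤ} {n : ℕ} (h : k % vs.length = n) (j : ℤ) :
    cyclicVertex vs (k + j) = cyclicVertex vs (n + j) :=
  cyclicVertex_congr (by rw [← h, Int.emod_add_emod])

/-- The lattice loop with a given list of vertices. -/
def LatticeLoop.ofList (vs : List (ℤ × ℤ)) (h : IsLoop vs) : LatticeLoop where
  length := vs.length
  length_pos := h.1
  vertex := cyclicVertex vs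
  periodic := fun k => cyclicVertex_congr (by simp)
  unit_step := by
    intro k
    obtain ⟨n, hn, e⟩ := exists_residue h.1 k
    have e0 := cyclicVertex_residue e 0
    rw [add_zero, add_zero] at e0
    rw [cyclicVertex_residue e, e0]
    exact (h.2 n hn).1
  no_backtrack := by
    intro k
    obtain ⟨n, hn, e⟩ := exists_residue h.1 k
    have e0 := cyclicVertex_residue e 0
    rw [add_zero, add_zero] at e0
    rw [cyclicVertex_residue e, sub_eq_add_neg k 1, cyclicVertex_residue e, e0]
    exact (h.2 n hn).2.1
  crossing := by
    intro k l
    obtain ⟨n, hn, e⟩ := exists_residue h.1 k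
    obtain ⟨m, hm, e'⟩ := exists_residue h.1 l
    have e0 := cyclicVertex_residue e 0
    have e0' := cyclicVertex_residue e' 0
    rw [add_zero, add_zero] at e0 e0'
    rw [cyclicVertex_residue e, sub_eq_add_neg k 1, cyclicVertex_residue e, e0,
      cyclicVertex_residue e', sub_eq_add_neg l 1, cyclicVertex_residue e', e0']
    intro hv
    -- `LoopAt` compares a vertex only with earlier ones; the other order follows from the
    -- antisymmetry of `det`.
    rcases lt_trichotomy m n with hmn | rfl | hmn
    · have := (h.2 n hn).2.2 m hmn hv.symm
      refine Or.inr ⟨this.2.1, this.1, fun h0 => this.2.2 ?_⟩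
      simp only [det] at h0 ⊢
      linarith
    · left
      exact Int.ModEq.dvd (e.trans e'.symm)
    · have := (h.2 m hm).2.2 n hmn hv
      exact Or.inr ⟨this.1, this.2.1, this.2.2⟩

/-! ### Crossings, moves and standard curves from finite checks. -/

namespace LatticeLoop

variable {G G' : LatticeLoop} {S S' : List (ℤ × ℤ)}

lemma isCrossingList_of (h : ∀ n < G.length,
    (G.vertex n ∈ S ↔ ∃ m, m < G.length ∧ m ≠ n ∧ G.vertex m = G.vertex n)) :
    G.IsCrossingList S := by
  intro k
  have hvert : ∀ (j : ℤ) (n : ℕ), j % G.length = n → G.vertex j = G.vertex n := by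
    intro j n e
    rw [← e, ← G.vertex_add_mul (j % G.length) (j / G.length), mul_comm, Int.emod_add_mul_ediv]
  obtain ⟨n, hn, e⟩ := exists_residue G.length_pos k
  rw [hvert k n e, h n hn]
  constructor
  · rintro ⟨m, hm, hmn, hv⟩
    refine ⟨m, hv, fun hd => hmn ?_⟩
    have := Int.ModEq.symm ((Int.modEq_iff_dvd).2 hd)
    have h2 : (m : ℤ) % G.length = k % G.length := this
    rw [e, Int.emod_eq_of_lt (by omega) (by omega)] at h2
    exact_mod_cast h2
  · rintro ⟨l, hl, hd⟩
    obtain ⟨m, hm, e'⟩ := exists_residue G.length_pos l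
    refine ⟨m, hm, ?_, by rw [← hvert l m e', hl]⟩
    rintro rfl
    exact hd ((Int.modEq_iff_dvd).1 (e.trans e'.symm))

/-- The number of left turns minus the number of right turns. -/
def turning (G : LatticeLoop) : ℤ := ∑ k ∈ Finset.range G.length, det (G.step (k - 1)) (G.step k)

lemma index_curve_eq (G : LatticeLoop) {h : ℝ} (hh : 0 < h) :
    (G.curve h hh).index = (G.turning : ℝ) / 4 := G.index_curve h hh

/-- The starting times `m` and `m'` play the role of base points, so each move can be read off from
suitably rotated words. -/
lemma curveMove {R : Nanoword ℂ → Nanoword ℂ → Prop} (hS : G.IsCrossingList S)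
    (hS' : G'.IsCrossingList S') {h : ℝ} (hh : 0 < h) (ht : G.turning = G'.turning) (m m' : ℤ)
    (hR : ∀ w w', (G.walkWord S m).Iso w → (G'.walkWord S' m').Iso w' → R w w') :
    CurveMove R (G.curve h hh) (G'.curve h hh) := by
  refine ⟨by rw [index_curve_eq, index_curve_eq, ht], ?_⟩
  obtain ⟨b, hb, hi⟩ := exists_basePoint hS hh m
  obtain ⟨b', hb', hi'⟩ := exists_basePoint hS' hh m'
  exact ⟨b, b', hb, hb', hR _ _ hi hi'⟩

lemma curveMove_IIPlus (hS : G.IsCrossingList S) (hS' : G'.IsCrossingList S') {h : ℝ} (hh : 0 < h)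
    (ht : G.turning = G'.turning) (m m' : ℤ) (x y z : List ℕ) (A B : ℕ) (σ : ℕ → ℤ)
    (hw : A ≠ B ∧ A ∉ x ++ y ++ z ∧ B ∉ x ++ y ++ z ∧ σ B = - σ A ∧
      (Nanoword.mk (x ++ y ++ z) σ).Matches (G.walkWord S m) ∧
      (Nanoword.mk (x ++ [A, B] ++ y ++ [A, B] ++ z) σ).Matches (G'.walkWord S' m')) :
    CurveMove WordMoveIIPlus (G.curve h hh) (G'.curve h hh) :=
  curveMove hS hS' hh ht m m' fun _ _ hi hi' => ⟨x, y, z, A, B, σ, hw.1, hw.2.1, hw.2.2.1,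
    hw.2.2.2.1, hw.2.2.2.2.1.iso.trans hi, hw.2.2.2.2.2.iso.trans hi'⟩

lemma curveMove_IIMinus (hS : G.IsCrossingList S) (hS' : G'.IsCrossingList S') {h : ℝ} (hh : 0 < h)
    (ht : G.turning = G'.turning) (m m' : ℤ) (x y z : List ℕ) (A B : ℕ) (σ : ℕ → ℤ)
    (hw : A ≠ B ∧ A ∉ x ++ y ++ z ∧ B ∉ x ++ y ++ z ∧ σ B = - σ A ∧
      (Nanoword.mk (x ++ y ++ z) σ).Matches (G.walkWord S m) ∧
      (Nanoword.mk (x ++ [A, B] ++ y ++ [B, A] ++ z) σ).Matches (G'.walkWord S' m')) :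
    CurveMove WordMoveIIMinus (G.curve h hh) (G'.curve h hh) :=
  curveMove hS hS' hh ht m m' fun _ _ hi hi' => ⟨x, y, z, A, B, σ, hw.1, hw.2.1, hw.2.2.1,
    hw.2.2.2.1, hw.2.2.2.2.1.iso.trans hi, hw.2.2.2.2.2.iso.trans hi'⟩

lemma curveMove_III (hS : G.IsCrossingList S) (hS' : G'.IsCrossingList S') {h : ℝ} (hh : 0 < h)
    (ht : G.turning = G'.turning) (m m' : ℤ) (x y z t : List ℕ) (A B C : ℕ) (σ : ℕ → ℤ)
    (hw : A ≠ B ∧ A ≠ C ∧ B ≠ C ∧ A ∉ x ++ y ++ z ++ t ∧ B ∉ x ++ y ++ z ++ t ∧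
      C ∉ x ++ y ++ z ++ t ∧ σ A = σ B ∧ σ B = σ C ∧
      (Nanoword.mk (x ++ [A, B] ++ y ++ [A, C] ++ z ++ [B, C] ++ t) σ).Matches (G.walkWord S m) ∧
      (Nanoword.mk (x ++ [B, A] ++ y ++ [C, A] ++ z ++ [C, B] ++ t) σ).Matches
        (G'.walkWord S' m')) :
    CurveMove WordMoveIII (G.curve h hh) (G'.curve h hh) :=
  curveMove hS hS' hh ht m m' fun _ _ hi hi' => by
    obtain ⟨h1, h2, h3, h4, h5, h6, h7, h8, h9, h10⟩ := hw
    exact ⟨x, y, z, t, A, B, C, σ, h1, h2, h3, h4, h5, h6, h7, h8, h9.iso.trans hi,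
      h10.iso.trans hi'⟩

lemma isStandard_two (hS : G.IsCrossingList S) {h : ℝ} (hh : 0 < h) (ht : G.turning = 8) (m : ℤ)
    (hw : (Nanoword.mk [0, 0] fun _ => 1).Matches (G.walkWord S m)) :
    IsStandard 2 (G.curve h hh) := by
  refine ⟨by rw [index_curve_eq, ht]; norm_num, ?_⟩
  obtain ⟨b, hb, hi⟩ := exists_basePoint hS hh m
  exact ⟨b, hb, hw.iso.trans hi⟩

end LatticeLoop

/-! ### The walks -/

/-- The unit step to the right. -/
def east : ℤ × ℤ := (1, 0)

/-- The unit step up. -/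
def north : ℤ × ℤ := (0, 1)

/-- The unit step to the left. -/
def west : ℤ × ℤ := (-1, 0)

/-- The unit step down. -/
def south : ℤ × ℤ := (0, -1)

/-- The walk that starts at `(-3, 0)` and consists of straight runs. -/
def walkOf (l : List (ℕ × (ℤ × ℤ))) : List (ℤ × ℤ) :=
  verticesFrom (-3, 0) (l.flatMap fun r => List.replicate r.1 r.2)

/-- The rest of a standard curve of index `2` whose inner loop contains the horizontal strand. -/
def innerRest : List (ℕ × (ℤ × ℤ)) :=
  [(1, east), (4, north), (8, west), (9, south), (10, east), (11, north), (12, west), (6, south),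
    (3, east)]

/-- The rest of a standard curve of index `2` whose outer part contains the horizontal strand. -/
def outerRest : List (ℕ × (ℤ × ℤ)) :=
  [(1, east), (7, north), (5, west), (1, south), (1, east), (2, north), (4, west), (8, south),
    (1, east)]

/-- The straight strand. -/
def straightArc : List (ℕ × (ℤ × ℤ)) := [(6, east)]

/-- A strand with word `ABBA`. -/
def arcABBA : List (ℕ × (ℤ × ℤ)) :=
  [(2, east), (2, north), (1, east), (1, south), (2, west), (2, south), (2, east), (1, north),
    (3, east)]

/-- A strand with word `ABCDBADC`. -/
def arcABCDBADC : List (ℕ × (ℤ × ℤ)) :=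
  [(4, east), (2, north), (2, west), (3, south), (1, west), (2, north), (4, east), (1, south),
    (1, east)]

/-- A strand with word `ABCADDBC`. -/
def arcABCADDBC : List (ℕ × (ℤ × ℤ)) :=
  [(4, east), (2, north), (2, west), (4, south), (1, west), (1, north), (2, east), (2, north),
    (2, east), (1, south), (1, east)]

/-- A strand with a pair of opposite kinks. -/
def kinkArc : List (ℕ × (ℤ × ℤ)) :=
  [(3, east), (1, north), (1, west), (3, south), (1, west), (1, north), (3, east), (1, north),
    (2, east)]

open LatticeLoop

/-! ### The curves and their words -/

/-- The walk composed of `straightArc` and `innerRest`. -/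
def innerStraight : LatticeLoop := .ofList (walkOf (straightArc ++ innerRest)) (by decide +kernel)

lemma innerStraight_crossings : innerStraight.IsCrossingList
    [(-4, 0)] :=
  isCrossingList_of (by decide +kernel)

lemma innerStraight_turning : innerStraight.turning = 8 := by decide +kernel

/-- The walk composed of `arcABBA` and `innerRest`. -/
def innerABBA : LatticeLoop := .ofList (walkOf (arcABBA ++ innerRest)) (by decide +kernel)

lemma innerABBA_crossings : innerABBA.IsCrossingList
    [(-4, 0), (-2, 0), (-1, 1)] :=
  isCrossingList_of (by decide +kernel)

lemma innerABBA_turning : innerABBA.turning = 8 := by decide +kernel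

/-- The walk composed of `arcABCDBADC` and `innerRest`. -/
def innerABCDBADC : LatticeLoop := .ofList (walkOf (arcABCDBADC ++ innerRest)) (by decide +kernel)

lemma innerABCDBADC_crossings : innerABCDBADC.IsCrossingList
    [(-4, 0), (-2, 0), (-1, 0), (-1, 1), (1, 1)] :=
  isCrossingList_of (by decide +kernel)

lemma innerABCDBADC_turning : innerABCDBADC.turning = 8 := by decide +kernel

/-- The walk composed of `arcABCADDBC` and `innerRest`. -/
def innerABCADDBC : LatticeLoop := .ofList (walkOf (arcABCADDBC ++ innerRest)) (by decide +kernel)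

lemma innerABCADDBC_crossings : innerABCADDBC.IsCrossingList
    [(-4, 0), (-1, -1), (-1, 0), (0, 0), (1, 1)] :=
  isCrossingList_of (by decide +kernel)

lemma innerABCADDBC_turning : innerABCADDBC.turning = 8 := by decide +kernel

/-- The walk composed of `kinkArc` and `innerRest`. -/
def innerKink : LatticeLoop := .ofList (walkOf (kinkArc ++ innerRest)) (by decide +kernel)

lemma innerKink_crossings : innerKink.IsCrossingList
    [(-4, 0), (-1, -1), (-1, 0)] :=
  isCrossingList_of (by decide +kernel)

lemma innerKink_turning : innerKink.turning = 8 := by decide +kernel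

lemma innerStraight_isStandard {h : ℝ} (hh : 0 < h) : IsStandard 2 (innerStraight.curve h hh) :=
  -- Time `40` lies on the outer part, from which the loop has sign `1`. From time `0`, on the inner
  -- loop, the sign would be `-1`.
  isStandard_two innerStraight_crossings hh innerStraight_turning 40 (by decide +kernel)

/-- The strand evolves as empty word, `ABBA`, `ABCDBADC`, `ABCADDBC`, `AABB`. The lists of integers
in the moves give the signs of the letters `0, 1, 2, …`; the last letter is the crossing of `K_2`.
-/
theorem innerKink_arnoldValue {h : ℝ} (hh : 0 < h) :
    ArnoldValue (innerKink.curve h hh) (-4) (-7) 2 := by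
  have h₀ := ArnoldValue.standard 2 1 _ (by norm_num) (innerStraight_isStandard hh)
  have h₁ := ArnoldValue.moveIIMinus _ _ _ _ _ (curveMove_IIMinus innerStraight_crossings
    innerABBA_crossings hh (innerStraight_turning.trans innerABBA_turning.symm) 0 0
    [] [] [2, 2] 0 1 (fun n => [1, -1, -1].getD n 0) (by decide +kernel)) h₀
  have h₂ := ArnoldValue.moveIIMinus _ _ _ _ _ (curveMove_IIMinus innerABBA_crossings
    innerABCDBADC_crossings hh (innerABBA_turning.trans innerABCDBADC_turning.symm) 0 0
    [] [2, 3] [3, 2, 4, 4] 0 1 (fun n => [-1, 1, 1, -1, -1].getD n 0) (by decide +kernel)) h₁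
  -- The words are read from the lower left turn of the strand, so that the three pairs of
  -- neighbouring letters appear in the order of the move. The start is `12` in the second walk
  -- because its downward run is one step longer.
  have h₃ := ArnoldValue.moveIII _ _ _ _ _ (curveMove_III innerABCDBADC_crossings
    innerABCADDBC_crossings hh (innerABCDBADC_turning.trans innerABCADDBC_turning.symm) 11 12
    [] [2, 3, 3] [2] [] 0 1 4 (fun n => [1, 1, -1, -1, 1].getD n 0) (by decide +kernel)) h₂
  -- `ABCADDBC` arises from `AADD` by inserting `BC` twice, so the move is applied backwards.
  exact ArnoldValue.moveIIPlus_inv _ _ _ _ _ (curveMove_IIPlus innerKink_crossings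
    innerABCADDBC_crossings hh (innerKink_turning.trans innerABCADDBC_turning.symm) 0 0
    [0] [0, 3, 3] [4, 4] 1 2 (fun n => [1, -1, 1, -1, -1].getD n 0) (by decide +kernel)) h₃

/-- The square has half-width `3` and the kinked arc has `16` steps. It makes a counterclockwise
loop at `(-1, 0)` between times `2` and `6`, then a clockwise one at `(-1, -1)` between times `7`
and `11`. -/
lemma inner_kinkInsertion : KinkInsertion innerStraight innerKink 3 16 2 6 7 11 where
  pos := by norm_num
  length_lt := by decide +kernel
  length_add := by decide +kernel
  strand := by decide +kernel
  common := by decide +kernel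
  inside := by decide +kernel
  outside := by decide +kernel
  double := by decide +kernel
  order := by norm_num
  sign := by decide +kernel

/-- From the outer part the word is `CAABBC` with product of signs `-1`, counted with coefficient
`-1`. Moving the base point changes a sign and the pattern together. -/
lemma innerKink_pairings : ∀ n < innerKink.length,
    pairXYXYZZDec (innerKink.walkWord [(-4, 0), (-1, -1), (-1, 0)] n) = 0 ∧
      pairXXYYZZDec (innerKink.walkWord [(-4, 0), (-1, -1), (-1, 0)] n) = 1 := by
  decide +kernel

/-! ### The same strands on the outer part of `K_2`. -/

/-- The walk composed of `straightArc` and `outerRest`. -/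
def outerStraight : LatticeLoop := .ofList (walkOf (straightArc ++ outerRest)) (by decide +kernel)

lemma outerStraight_crossings : outerStraight.IsCrossingList
    [(0, 7)] :=
  isCrossingList_of (by decide +kernel)

lemma outerStraight_turning : outerStraight.turning = 8 := by decide +kernel

/-- The walk composed of `arcABBA` and `outerRest`. -/
def outerABBA : LatticeLoop := .ofList (walkOf (arcABBA ++ outerRest)) (by decide +kernel)

lemma outerABBA_crossings : outerABBA.IsCrossingList
    [(-2, 0), (-1, 1), (0, 7)] :=
  isCrossingList_of (by decide +kernel)

lemma outerABBA_turning : outerABBA.turning = 8 := by decide +kernel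

/-- The walk composed of `arcABCDBADC` and `outerRest`. -/
def outerABCDBADC : LatticeLoop := .ofList (walkOf (arcABCDBADC ++ outerRest)) (by decide +kernel)

lemma outerABCDBADC_crossings : outerABCDBADC.IsCrossingList
    [(-2, 0), (-1, 0), (-1, 1), (0, 7), (1, 1)] :=
  isCrossingList_of (by decide +kernel)

lemma outerABCDBADC_turning : outerABCDBADC.turning = 8 := by decide +kernel

/-- The walk composed of `arcABCADDBC` and `outerRest`. -/
def outerABCADDBC : LatticeLoop := .ofList (walkOf (arcABCADDBC ++ outerRest)) (by decide +kernel)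

lemma outerABCADDBC_crossings : outerABCADDBC.IsCrossingList
    [(-1, -1), (-1, 0), (0, 0), (0, 7), (1, 1)] :=
  isCrossingList_of (by decide +kernel)

lemma outerABCADDBC_turning : outerABCADDBC.turning = 8 := by decide +kernel

/-- The walk composed of `kinkArc` and `outerRest`. -/
def outerKink : LatticeLoop := .ofList (walkOf (kinkArc ++ outerRest)) (by decide +kernel)

lemma outerKink_crossings : outerKink.IsCrossingList
    [(-1, -1), (-1, 0), (0, 7)] :=
  isCrossingList_of (by decide +kernel)

lemma outerKink_turning : outerKink.turning = 8 := by decide +kernel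

lemma outerStraight_isStandard {h : ℝ} (hh : 0 < h) : IsStandard 2 (outerStraight.curve h hh) :=
  isStandard_two outerStraight_crossings hh outerStraight_turning 0 (by decide +kernel)

/-- The moves take place inside the strand and repeat those of the inner case. Only the sign of the
last letter differs, since time `0` now lies on the outer part. -/
theorem outerKink_arnoldValue {h : ℝ} (hh : 0 < h) :
    ArnoldValue (outerKink.curve h hh) (-4) (-7) 2 := by
  have h₀ := ArnoldValue.standard 2 1 _ (by norm_num) (outerStraight_isStandard hh)
  have h₁ := ArnoldValue.moveIIMinus _ _ _ _ _ (curveMove_IIMinus outerStraight_crossings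
    outerABBA_crossings hh (outerStraight_turning.trans outerABBA_turning.symm) 0 0
    [] [] [2, 2] 0 1 (fun n => [1, -1, 1].getD n 0) (by decide +kernel)) h₀
  have h₂ := ArnoldValue.moveIIMinus _ _ _ _ _ (curveMove_IIMinus outerABBA_crossings
    outerABCDBADC_crossings hh (outerABBA_turning.trans outerABCDBADC_turning.symm) 0 0
    [] [2, 3] [3, 2, 4, 4] 0 1 (fun n => [-1, 1, 1, -1, 1].getD n 0) (by decide +kernel)) h₁
  have h₃ := ArnoldValue.moveIII _ _ _ _ _ (curveMove_III outerABCDBADC_crossings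
    outerABCADDBC_crossings hh (outerABCDBADC_turning.trans outerABCADDBC_turning.symm) 11 12
    [] [2, 3, 3] [2] [] 0 1 4 (fun n => [1, 1, -1, 1, 1].getD n 0) (by decide +kernel)) h₂
  exact ArnoldValue.moveIIPlus_inv _ _ _ _ _ (curveMove_IIPlus outerKink_crossings
    outerABCADDBC_crossings hh (outerKink_turning.trans outerABCADDBC_turning.symm) 0 0
    [0] [0, 3, 3] [4, 4] 1 2 (fun n => [1, -1, 1, -1, 1].getD n 0) (by decide +kernel)) h₃

lemma outer_kinkInsertion : KinkInsertion outerStraight outerKink 3 16 2 6 7 11 where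
  pos := by norm_num
  length_lt := by decide +kernel
  length_add := by decide +kernel
  strand := by decide +kernel
  common := by decide +kernel
  inside := by decide +kernel
  outside := by decide +kernel
  double := by decide +kernel
  order := by norm_num
  sign := by decide +kernel

/-- From time `0` the word is `AABBCC`, with the same product of signs `-1` but coefficient `+1`. -/
lemma outerKink_pairings : ∀ n < outerKink.length,
    pairXYXYZZDec (outerKink.walkWord [(-1, -1), (-1, 0), (0, 7)] n) = 0 ∧
      pairXXYYZZDec (outerKink.walkWord [(-1, -1), (-1, 0), (0, 7)] n) = -1 := by
  decide +kernel

end CurveWords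

theorem mainTheorem8 :
    ∃ Γ₁ Γ₂ : CurveWords.ClosedCurve,
      (Γ₁.index = 2 ∧ Γ₂.index = 2) ∧
      (CurveWords.ArnoldValue Γ₁ (-4) (-7) 2 ∧ CurveWords.ArnoldValue Γ₂ (-4) (-7) 2) ∧
      (CurveWords.HasHomfly Γ₁
          (CurveWords.homflyX ^ 2 * CurveWords.homflyZ 2 (by norm_num)) ∧
        CurveWords.HasHomfly Γ₂
          (CurveWords.homflyX ^ 2 * CurveWords.homflyZ 2 (by norm_num))) ∧
      (∀ b, Γ₁.IsBasePoint b → ∀ s t : ℝ, CurveWords.CI3 Γ₁ b s t = t + 2) ∧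
      (∀ b, Γ₂.IsBasePoint b → ∀ s t : ℝ, CurveWords.CI3 Γ₂ b s t = -t + 2) ∧
      (∀ b₁ b₂, Γ₁.IsBasePoint b₁ → Γ₂.IsBasePoint b₂ → ∀ s t : ℝ, t ≠ 0 →
        CurveWords.CI3 Γ₁ b₁ s t ≠ CurveWords.CI3 Γ₂ b₂ s t) := by
  open CurveWords LatticeLoop in
  have i₁ : (innerKink.curve _ inner_kinkInsertion.mesh_pos).index = 2 := by
    rw [index_curve_eq, innerKink_turning]; norm_num
  have i₂ : (outerKink.curve _ outer_kinkInsertion.mesh_pos).index = 2 := by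
    rw [index_curve_eq, outerKink_turning]; norm_num
  have c₁ : ∀ b, (innerKink.curve _ inner_kinkInsertion.mesh_pos).IsBasePoint b → ∀ s t : ℝ,
      CI3 (innerKink.curve _ inner_kinkInsertion.mesh_pos) b s t = t + 2 := by
    intro b hb s t
    rw [CI3_curve innerKink_crossings _ innerKink_pairings hb, i₁]
    push_cast; ring
  have c₂ : ∀ b, (outerKink.curve _ outer_kinkInsertion.mesh_pos).IsBasePoint b → ∀ s t : ℝ,
      CI3 (outerKink.curve _ outer_kinkInsertion.mesh_pos) b s t = -t + 2 := by
    intro b hb s t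
    rw [CI3_curve outerKink_crossings _ outerKink_pairings hb, i₂]
    push_cast; ring
  refine ⟨_, _, ⟨i₁, i₂⟩, ⟨innerKink_arnoldValue _, outerKink_arnoldValue _⟩,
    ⟨hasHomfly_kinkPair inner_kinkInsertion.kinkPair
        (hasHomfly_standard _ _ _ (innerStraight_isStandard _)),
      hasHomfly_kinkPair outer_kinkInsertion.kinkPair
        (hasHomfly_standard _ _ _ (outerStraight_isStandard _))⟩, c₁, c₂, ?_⟩
  intro b₁ b₂ hb₁ hb₂ s t ht
  rw [c₁ b₁ hb₁, c₂ b₂ hb₂]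
  intro h
  exact ht (by linarith)
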